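/- **Model.** Let $m\ge 0$ be an integer and let $\alpha>\tfrac12$, $\beta\ge 0$, $\Delta>0$, $0<\delta<\tfrac{40}{81}$ be real numbers. A Prism system has $m+1$ categories of blocks: $0$-blocks (proposer blocks) and $j$-blocks for $1\le j\le m$ (voter blocks). In each category, block $0$ (genesis) is honest and is mined and published at time $0$; blocks $1,2,\dots$ are numbered in the order in which they are mined, finitely many in bounded time. Each non-genesis block has a parent of the same category that was mined strictly earlier, is published no earlier than it is mined (possibly never), and no earlier than its parent. The height of a block is the number of non-genesis blocks on its blockchain, i.e. on the path from genesis to it. A blockchain (identified with its last block) is *$t$-credible* if it is published by time $t$ and is at least as high as every blockchain of its category published by time $t-\Delta$. An honest block mined at time $T$ extends a $T$-credible blockchain and is published at time $T$; adversarial blocks are unrestricted. *Votes.* Let $R_h$ be the time at which the first proposer block of height $h$ is published. A voter block mined at time $T$ may vote, on each height $h$ with $R_h<T$, for one already mined proposer block of that height. If the voter block is honest, it votes on every height $h\ge 1$ with $R_h\le T-\Delta$ that none of its ancestors has voted on, never votes on a height on which an ancestor has voted, and votes for the first proposer block of the height that it has observed (a published block being observed after a delay of at most $\Delta$). For each voter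 blockchain only the first vote on each height counts. A sequence $(0,b_1,\dots,b_n)$ is a *$t$-credible leader sequence* if $n$ is at least the height of every proposer blockchain published by time $t-\Delta$, and there is a choice of one $t$-credible $j$-blockchain for each $j=1,\dots,m$ such that, for every $1\le \ell\le n$, $b_\ell$ is a proposer block of height $\ell$ with the most votes from these blockchains among all proposer blocks of height $\ell$ (a block without votes qualifies only if it is published by time $t$), ties being broken by a fixed rule that depends only on the set of tied blocks. Its $h$-high prefix is $(0,b_1,\dots,b_h)$; the prefix is *permanent after $t$* if it is an initial segment of every $r$-credible leader sequence for every $r\ge t$. *Randomness.* The whole evolution is random. For each $j$ the honest $j$-blocks arrive according to a homogeneous Poisson process of rate $\alpha$, independently over $j$, and for all $0\le s<t$ the number $Z^j_t-Z^j_s$ of adversarial $j$-blocks mined during $(s,t]$ satisfies $P(Z^j_t-Z^j_s\le a)\ge e^{-\beta(t-s)}\sum_{i=0}^{a}\frac{(\beta(t-s))^i}{i!}$ for all integers $a\ge 0$. Otherwise the adversarial behaviour and the network delays (at most $\Delta$) are arbitrary. Put $$g=e^{-\alpha\Delta},\qquad \eta=\delta^2g^2\alpha,\qquad \mu=\frac{9e^{2\eta/27}}{(1-e^{-\eta/27})^2},$$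 and assume $(1-\tfrac{81}{40}\delta)g^2\alpha>\beta$. **Statement.** Fix a positive integer $h$ and $\varepsilon$ with $0<\varepsilon<m\mu e^{-3(1+\Delta)\delta g^2\alpha}$, and put $$C=\frac{1}{(1-\frac{41}{40}\delta)(1-g)g\alpha}\left(\frac{54\alpha}{\eta}\log\frac{m\mu}{\varepsilon}+4\alpha\Delta+1\right)+\Delta .$$ Then for every real number $t$ there is an event of probability at least $1-\varepsilon$ on which the following holds: if $R_h+C\le t$, then every $t$-credible leader sequence $(0,b_1,\dots,b_n)$ has $n\ge h$, and its $h$-high prefix is permanent after time $t$. (The confirmation delay $C$ is thus logarithmic in $1/\varepsilon$.) -/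

import Mathlib

open MeasureTheory ProbabilityTheory Filter Topology
open scoped NNReal ENNReal

namespace Prism

/-- The outcome of the mining process of one category of blocks (the `j`-blocks, for one `j`).
Blocks are numbered `0, 1, 2, …` in the order in which they are mined; block `0` is the genesis
block.  `T k` is the time at which block `k` is mined, `P k` the time at which it is published
(`⊤` if it never is), `parent k` the number of its parent block (no meaning for `k = 0`), and
`honest k` says whether it was mined by an honest miner. -/
structure BlockTree where
  T : ℕ → ℝ
  P : ℕ → EReal
  parent : ℕ → ℕ
  honest : ℕ → Prop
  T_zero : T 0 = 0
  P_zero : P 0 = 0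
  honest_zero : honest 0
  T_mono : Monotone T
  /-- Only finitely many blocks are mined in bounded time. -/
  T_tendsto : Tendsto T atTop atTop
  parent_lt : ∀ k, k ≠ 0 → parent k < k
  /-- A parent is mined strictly earlier. -/
  T_parent_lt : ∀ k, k ≠ 0 → T (parent k) < T k
  /-- A block is published no earlier than it is mined. -/
  T_le_P : ∀ k, (T k : EReal) ≤ P k
  /-- Publishing a block means publishing the whole blockchain that validates it. -/
  P_parent_le : ∀ k, k ≠ 0 → P (parent k) ≤ P k

namespace BlockTree

variable (B : BlockTree)

/-- Blockchain `k`: the sequence `(b₀, …, bₙ)` with `b₀ = 0`, `bₙ = k` in which each block is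
followed by a child. -/
def chain (k : ℕ) : List ℕ :=
  if _h : k = 0 then [0] else chain (B.parent k) ++ [k]
termination_by k
decreasing_by exact B.parent_lt k _h

/-- The height of block(chain) `k`: the number of non-genesis blocks in blockchain `k`. -/
def height (k : ℕ) : ℕ := (B.chain k).length - 1

/-- Blockchain `b` is `t`-credible: it has been published by time `t` and is no shorter than any
blockchain published by time `t - Δ`. -/
def IsCredible (Δ t : ℝ) (b : ℕ) : Prop :=
  B.P b ≤ (t : EReal) ∧ ∀ k, B.P k ≤ ((t - Δ : ℝ) : EReal) → B.height k ≤ B.height b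

/-- The number of honest non-genesis blocks mined by time `t`. -/
noncomputable def honestCount (t : ℝ) : ℕ := {k : ℕ | k ≠ 0 ∧ B.honest k ∧ B.T k ≤ t}.ncard

/-- The number of adversarial blocks mined by time `t`. -/
noncomputable def adversarialCount (t : ℝ) : ℕ :=
  {k : ℕ | k ≠ 0 ∧ ¬ B.honest k ∧ B.T k ≤ t}.ncard

/-- The time at which the first block of height `h` is published (`⊤` if there is none). -/
noncomputable def firstPublished (h : ℕ) : EReal := ⨅ (k : ℕ) (_ : B.height k = h), B.P k

/-- The bitcoin rule with delay bound `Δ`: an honest block `k` extends a `T k`-credible blockchain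
and is published as soon as it is mined. -/
def HonestRule (Δ : ℝ) : Prop :=
  ∀ k, k ≠ 0 → B.honest k → B.IsCredible Δ (B.T k) (B.parent k) ∧ B.P k = (B.T k : EReal)

/-- The vote on height `l` that is counted for blockchain `k`, when `vote b l` is the vote of block
`b` on height `l`: the first one along the blockchain. -/
def chainVote (vote : ℕ → ℕ → Option ℕ) (k l : ℕ) : Option ℕ :=
  (B.chain k).findSome? fun b => vote b l

end BlockTree

/-- One complete outcome of a Prism system with `m` voter blockchains and with propagation delays
bounded by `Δ`.  Which blocks the adversary mines, where it attaches them, when it publishes them,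
how it votes, and what the network does within the delay bound is left free. -/
structure Outcome (m : ℕ) (Δ : ℝ) where
  /-- The proposer blocks, i.e. the `0`-blocks, are `tree 0`; the voter blocks are the others. -/
  tree : Fin (m + 1) → BlockTree
  honestRule : ∀ j, (tree j).HonestRule Δ
  /-- `vote j k l` is the proposer block of height `l` for which block `k` of voter tree `j` votes,
  if any; among several votes of a block on one height only the first matters. -/
  vote : Fin m → ℕ → ℕ → Option ℕ
  /-- A vote on height `l` goes to an existing proposer block of that height, and only once that
  height has a published block. -/
  vote_valid : ∀ j k l p, vote j k l = some p →
    (tree 0).height p = l ∧ (tree 0).T p < (tree j.succ).T k ∧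
      (tree 0).firstPublished l < ((tree j.succ).T k : EReal)
  /-- An honest voter block votes on every height that has had a published block for at least `Δ`
  and has not been voted on by its ancestors. -/
  honest_votes : ∀ j k l, k ≠ 0 → l ≠ 0 → (tree j.succ).honest k →
    (tree 0).firstPublished l ≤ (((tree j.succ).T k - Δ : ℝ) : EReal) →
    (tree j.succ).chainVote (vote j) ((tree j.succ).parent k) l = none → (vote j k l).isSome
  /-- An honest voter block does not vote on a height on which its ancestors have voted. -/
  honest_no_repeat : ∀ j k l, k ≠ 0 → (tree j.succ).honest k → (vote j k l).isSome →
    (tree j.succ).chainVote (vote j) ((tree j.succ).parent k) l = none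
  /-- An honest voter block votes for the first proposer block of the height that it has observed.
  As blocks are observed within `Δ` of their publication, no block of that height was published
  more than `Δ` before the chosen one. -/
  honest_first : ∀ j k l p, k ≠ 0 → (tree j.succ).honest k → vote j k l = some p →
    (tree 0).P p ≤ ((tree j.succ).T k : EReal) ∧
      ∀ q, (tree 0).height q = l → (tree 0).P p ≤ (tree 0).P q + (Δ : EReal)
  /-- The rule that picks one out of a set of proposer blocks of equal height with equally many
  votes. -/
  tieBreak : Set ℕ → ℕ
  tieBreak_mem : ∀ S : Set ℕ, S.Nonempty → tieBreak S ∈ S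

namespace Outcome

variable {m : ℕ} {Δ : ℝ} (X : Outcome m Δ)

/-- The number of votes for proposer block `p` on height `l` from the voter blockchains `c j`. -/
def voteCount (c : Fin m → ℕ) (l p : ℕ) : ℕ :=
  (Finset.univ.filter fun j : Fin m =>
    (X.tree j.succ).chainVote (X.vote j) (c j) l = some p).card

/-- The proposer blocks of height `l` with the most votes at time `t` from the collection `c` of
voter blockchains.  A block without any vote qualifies only if it has been published by time `t`. -/
def mostVoted (c : Fin m → ℕ) (t : ℝ) (l : ℕ) : Set ℕ :=
  {p | (X.tree 0).height p = l ∧ ((X.tree 0).P p ≤ (t : EReal) ∨ 0 < X.voteCount c l p) ∧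
    ∀ q, (X.tree 0).height q = l → X.voteCount c l q ≤ X.voteCount c l p}

/-- `L = (0, b₁, …, bₙ)` is a `t`-credible leader sequence: `n` is at least the height of every
proposer blockchain published by time `t - Δ`, and there is a collection of `t`-credible voter
blockchains, one for each `j`, which elects `b_l` among the proposer blocks of height `l`, for every
`l = 1, …, n`. -/
def IsCredibleLeaderSequence (t : ℝ) (L : List ℕ) : Prop :=
  L[0]? = some 0 ∧
  (∀ k, (X.tree 0).P k ≤ ((t - Δ : ℝ) : EReal) → (X.tree 0).height k < L.length) ∧
  ∃ c : Fin m → ℕ, (∀ j, (X.tree j.succ).IsCredible Δ t (c j)) ∧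
    ∀ l b, l ≠ 0 → L[l]? = some b →
      (X.mostVoted c t l).Nonempty ∧ b = X.tieBreak (X.mostVoted c t l)

/-- The sequence `s = (0, b₁, …, b_h)` is permanent after time `t`: it remains (as an initial
segment) in all `r`-credible leader sequences with `r ≥ t`. -/
def IsPermanentAfter (t : ℝ) (s : List ℕ) : Prop :=
  ∀ r, t ≤ r → ∀ L, X.IsCredibleLeaderSequence r L → s <+: L

/-- `R_h`: the time when the first proposer block of height `h` is published. -/
noncomputable def R (h : ℕ) : EReal := (X.tree 0).firstPublished h

end Outcome

/-- A random Prism system: the outcome is random, with an arbitrary adversarial strategy subject to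
a bound on its mining rate.  For every `j`, the honest `j`-blocks arrive as a homogeneous Poisson
process of rate `α`, independently over `j`, and the number of adversarial `j`-blocks mined during
`(s, t]` is stochastically dominated by a Poisson variable of mean `β (t - s)`. -/
structure IsPrismSystem {Ω : Type*} [MeasurableSpace Ω] (Pr : Measure Ω) {m : ℕ} {Δ : ℝ}
    (α β : ℝ) (X : Ω → Outcome m Δ) : Prop where
  measurable_honest : ∀ j (t : ℝ≥0), Measurable fun ω => ((X ω).tree j).honestCount t
  indep_increments : ∀ j,
    HasIndepIncrements (fun (t : ℝ≥0) ω => ((X ω).tree j).honestCount t) Pr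
  poisson_increments : ∀ j (s t : ℝ≥0), s < t →
    HasLaw (fun ω => ((X ω).tree j).honestCount t - ((X ω).tree j).honestCount s)
      (poissonMeasure (Real.toNNReal (α * (t - s)))) Pr
  indep_trees : iIndepFun (fun j ω (t : ℝ≥0) => ((X ω).tree j).honestCount t) Pr
  measurable_adversarial : ∀ j (t : ℝ≥0), Measurable fun ω => ((X ω).tree j).adversarialCount t
  adversarial_bound : ∀ j (s t : ℝ≥0) (a : ℕ), s < t →
    ENNReal.ofReal (Real.exp (-(β * (t - s))) *
        ∑ i ∈ Finset.range (a + 1), (β * (t - s)) ^ i / (i.factorial : ℝ)) ≤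
      Pr {ω | ((X ω).tree j).adversarialCount t - ((X ω).tree j).adversarialCount s ≤ a}

/-- `g = e^{-αΔ}`. -/
noncomputable def g (α Δ : ℝ) : ℝ := Real.exp (-(α * Δ))

/-- `η = δ² g² α`. -/
noncomputable def eta (α Δ δ : ℝ) : ℝ := δ ^ 2 * g α Δ ^ 2 * α

/-- `μ = 9 e^{2η/27} / (1 - e^{-η/27})²`. -/
noncomputable def mu (α Δ δ : ℝ) : ℝ :=
  9 * Real.exp (2 / 27 * eta α Δ δ) / (1 - Real.exp (-(1 / 27 * eta α Δ δ))) ^ 2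

/-- The confirmation delay
`((54α/η) log(mμ/ε) + 4αΔ + 1) / ((1 - 41δ/40)(1 - g) g α) + Δ`. -/
noncomputable def confirmationDelay (m : ℕ) (α Δ δ ε : ℝ) : ℝ :=
  1 / ((1 - 41 / 40 * δ) * (1 - g α Δ) * g α Δ * α) *
    (54 * α / eta α Δ δ * Real.log (m * mu α Δ δ / ε) + 4 * α * Δ + 1) + Δ

end Prism

/-! Honest blocks mined at least Δ apart have increasing heights, so a loner is the only honest
block of its height. Take two blockchains credible at or after t, cut each back to a stub without
honest blocks mined after t, and let e be the highest common honest block of the stubs. If e is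
mined by time s, then every loner mined later than Δ after e and at least Δ before the later
credibility time has an adversarial block of its height on one of the stubs, with at most one
exception, mined in (t - Δ, t]. So if loners outnumber adversarial blocks by two on all intervals
around (s, t], any two such blockchains share an honest block mined in (s, t]
(`exists_common_honest`).

Loners appear at rate about g²α, adversarial blocks at rate at most β < (1 - 81δ/40)g²α. For
independence, time is cut into cells of length Δ/n, and loners are detected as isolated arrivals in
windows of 3n cells. The windows overlap but split into three families of disjoint ones, each with a
Chernoff bound (`loners_tail`). Together with the Poisson tail for adversarial blocks, failure is
exponentially unlikely in the length of the interval, and summing over both endpoints, grouped by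
unit intervals, gives a double geometric series (`loners_gt_adversarial_around`).

Now let s = t - C + Δ. This is deterministic, so no conditioning on R_h is needed. If R_h + C ≤ t, a
shared honest voter block mined after s ≥ R_h + Δ has votes on all heights up to h on its
blockchain. First votes count, so every blockchain through it carries the same votes, and the
leaders elected at time t and later agree (`isPermanentAfter_of_common_honest`). -/

namespace Prism

/-! ### Blockchains, heights and counts of blocks. -/

namespace BlockTree

variable (B : BlockTree)

lemma chain_zero : B.chain 0 = [0] := by
  rw [chain]; simp

lemma chain_of_ne_zero {k : ℕ} (hk : k ≠ 0) : B.chain k = B.chain (B.parent k) ++ [k] := by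
  rw [chain]; simp [hk]

lemma self_mem_chain (k : ℕ) : k ∈ B.chain k := by
  by_cases hk : k = 0
  · simp [hk, chain_zero]
  · simp [B.chain_of_ne_zero hk]

lemma chain_ne_nil (k : ℕ) : B.chain k ≠ [] := List.ne_nil_of_mem (B.self_mem_chain k)

lemma length_chain (k : ℕ) : (B.chain k).length = B.height k + 1 := by
  have := List.length_pos_iff.2 (B.chain_ne_nil k)
  unfold height; omega

lemma height_zero : B.height 0 = 0 := by simp [height, chain_zero]

lemma height_of_ne_zero {k : ℕ} (hk : k ≠ 0) : B.height k = B.height (B.parent k) + 1 := by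
  have h := B.length_chain k
  rw [B.chain_of_ne_zero hk, List.length_append, B.length_chain] at h
  simp at h; omega

lemma mem_chain_of_ne_zero {a k : ℕ} (hk : k ≠ 0) :
    a ∈ B.chain k ↔ a ∈ B.chain (B.parent k) ∨ a = k := by
  rw [B.chain_of_ne_zero hk]; simp

lemma mem_chain_zero {a : ℕ} : a ∈ B.chain 0 ↔ a = 0 := by simp [chain_zero]

lemma zero_mem_chain (k : ℕ) : 0 ∈ B.chain k := by
  induction k using Nat.strong_induction_on with
  | _ k ih =>
    by_cases hk : k = 0
    · simp [hk, chain_zero]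
    · exact (B.mem_chain_of_ne_zero hk).2 (Or.inl (ih _ (B.parent_lt k hk)))

lemma chain_prefix {a k : ℕ} (h : a ∈ B.chain k) : B.chain a <+: B.chain k := by
  induction k using Nat.strong_induction_on with
  | _ k ih =>
    by_cases hk : k = 0
    · subst hk; rw [B.mem_chain_zero.1 h]
    · rcases (B.mem_chain_of_ne_zero hk).1 h with h' | rfl
      · refine (ih _ (B.parent_lt k hk) h').trans ?_
        rw [B.chain_of_ne_zero hk]; exact List.prefix_append _ _
      · exact List.prefix_rfl

lemma le_of_mem_chain {a k : ℕ} (h : a ∈ B.chain k) : a ≤ k := by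
  induction k using Nat.strong_induction_on with
  | _ k ih =>
    by_cases hk : k = 0
    · subst hk; rw [B.mem_chain_zero.1 h]
    · rcases (B.mem_chain_of_ne_zero hk).1 h with h' | rfl
      · exact (ih _ (B.parent_lt k hk) h').trans (B.parent_lt k hk).le
      · exact le_rfl

lemma P_le_of_mem_chain {a k : ℕ} (h : a ∈ B.chain k) : B.P a ≤ B.P k := by
  induction k using Nat.strong_induction_on with
  | _ k ih =>
    by_cases hk : k = 0
    · subst hk; rw [B.mem_chain_zero.1 h]
    · rcases (B.mem_chain_of_ne_zero hk).1 h with h' | rfl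
      · exact (ih _ (B.parent_lt k hk) h').trans (B.P_parent_le k hk)
      · exact le_rfl

lemma T_lt_of_mem_chain {a k : ℕ} (h : a ∈ B.chain k) (hak : a ≠ k) : B.T a < B.T k := by
  have hk : k ≠ 0 := by
    rintro rfl; exact hak (B.mem_chain_zero.1 h)
  rcases (B.mem_chain_of_ne_zero hk).1 h with h' | h'
  · exact (B.T_mono (B.le_of_mem_chain h')).trans_lt (B.T_parent_lt k hk)
  · exact absurd h' hak

lemma mem_chain_of_height_le {a b k : ℕ} (ha : a ∈ B.chain k) (hb : b ∈ B.chain k)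
    (h : B.height a ≤ B.height b) : a ∈ B.chain b :=
  (List.prefix_of_prefix_length_le (B.chain_prefix ha) (B.chain_prefix hb) (by
    rw [B.length_chain, B.length_chain]; omega)).subset (B.self_mem_chain a)

lemma T_lt_of_height_lt {a b k : ℕ} (ha : a ∈ B.chain k) (hb : b ∈ B.chain k)
    (h : B.height a < B.height b) : B.T a < B.T b :=
  B.T_lt_of_mem_chain (B.mem_chain_of_height_le ha hb h.le) (by rintro rfl; omega)

lemma exists_mem_chain_height {k n : ℕ} (h : n ≤ B.height k) :
    ∃ a ∈ B.chain k, B.height a = n := by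
  induction k using Nat.strong_induction_on with
  | _ k ih =>
    by_cases hn : n = B.height k
    · exact ⟨k, B.self_mem_chain k, hn.symm⟩
    · have hk : k ≠ 0 := by
        rintro rfl; rw [B.height_zero] at h hn; omega
      rw [B.height_of_ne_zero hk] at h hn
      obtain ⟨a, ha, hh⟩ := ih _ (B.parent_lt k hk) (by omega)
      exact ⟨a, (B.mem_chain_of_ne_zero hk).2 (Or.inl ha), hh⟩

lemma T_nonneg (k : ℕ) : 0 ≤ B.T k := B.T_zero ▸ B.T_mono (Nat.zero_le k)

lemma finite_T_le (t : ℝ) : {k | B.T k ≤ t}.Finite := by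
  obtain ⟨N, hN⟩ := (B.T_tendsto.eventually_gt_atTop t).exists_forall_of_atTop
  refine (Set.finite_lt_nat N).subset fun k hk => ?_
  by_contra hlt
  exact absurd (hN k (not_lt.1 hlt)) (not_lt.2 hk)

/-- The adversarial blocks mined during `(u, v]`. -/
def adversarialBlocks (u v : ℝ) : Set ℕ := {k | k ≠ 0 ∧ ¬ B.honest k ∧ u < B.T k ∧ B.T k ≤ v}

/-- The honest non-genesis blocks mined during `(u, v]`. -/
def honestBlocks (u v : ℝ) : Set ℕ := {k | k ≠ 0 ∧ B.honest k ∧ u < B.T k ∧ B.T k ≤ v}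

/-- The loners mined during `(u, v]`: honest non-genesis blocks such that no other such block is
mined within `Δ`. -/
def loners (Δ u v : ℝ) : Set ℕ :=
  {k | k ∈ B.honestBlocks u v ∧ ∀ i, i ≠ 0 → B.honest i → i ≠ k → Δ < |B.T i - B.T k|}

lemma finite_adversarialBlocks (u v : ℝ) : (B.adversarialBlocks u v).Finite :=
  (B.finite_T_le v).subset fun _ h => h.2.2.2

lemma finite_honestBlocks (u v : ℝ) : (B.honestBlocks u v).Finite :=
  (B.finite_T_le v).subset fun _ h => h.2.2.2

lemma finite_loners (Δ u v : ℝ) : (B.loners Δ u v).Finite :=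
  (B.finite_honestBlocks u v).subset fun _ h => h.1

lemma ncard_honestBlocks {u v : ℝ} (h : u ≤ v) :
    (B.honestBlocks u v).ncard = B.honestCount v - B.honestCount u := by
  have hs : {k : ℕ | k ≠ 0 ∧ B.honest k ∧ B.T k ≤ u} ⊆ {k : ℕ | k ≠ 0 ∧ B.honest k ∧ B.T k ≤ v} :=
    fun k hk => ⟨hk.1, hk.2.1, hk.2.2.trans h⟩
  have hf : {k : ℕ | k ≠ 0 ∧ B.honest k ∧ B.T k ≤ u}.Finite :=
    (B.finite_T_le u).subset fun _ h => h.2.2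
  unfold honestCount
  rw [← Set.ncard_sdiff hs hf]
  congr 1; ext k
  simp only [honestBlocks, Set.mem_ofPred_eq, Set.mem_sdiff, not_and, not_le]
  tauto

lemma ncard_adversarialBlocks {u v : ℝ} (h : u ≤ v) :
    (B.adversarialBlocks u v).ncard = B.adversarialCount v - B.adversarialCount u := by
  have hs : {k : ℕ | k ≠ 0 ∧ ¬ B.honest k ∧ B.T k ≤ u} ⊆
      {k : ℕ | k ≠ 0 ∧ ¬ B.honest k ∧ B.T k ≤ v} :=
    fun k hk => ⟨hk.1, hk.2.1, hk.2.2.trans h⟩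
  have hf : {k : ℕ | k ≠ 0 ∧ ¬ B.honest k ∧ B.T k ≤ u}.Finite :=
    (B.finite_T_le u).subset fun _ h => h.2.2
  unfold adversarialCount
  rw [← Set.ncard_sdiff hs hf]
  congr 1; ext k
  simp only [adversarialBlocks, Set.mem_ofPred_eq, Set.mem_sdiff, not_and, not_le]
  tauto

/-! ### Loners and common honest blocks. -/

section HonestRule

variable {B} {Δ : ℝ}

lemma P_eq_of_honest (hB : B.HonestRule Δ) {k : ℕ} (hk : B.honest k) : B.P k = (B.T k : EReal) := by
  by_cases h0 : k = 0
  · subst h0; rw [B.P_zero, B.T_zero]; rfl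
  · exact (hB k h0 hk).2

/-- Block `i` is published when mined, so the credible parent of `k` is at least as high as `i`. -/
lemma height_lt_of_honest (hB : B.HonestRule Δ) {i k : ℕ} (hi : B.honest i) (hk0 : k ≠ 0)
    (hk : B.honest k) (h : B.T i ≤ B.T k - Δ) : B.height i < B.height k := by
  have h1 := (hB k hk0 hk).1.2 i (by rw [P_eq_of_honest hB hi]; exact_mod_cast h)
  rw [B.height_of_ne_zero hk0]; omega

lemma height_pos {k : ℕ} (hk : k ≠ 0) : 0 < B.height k := by
  rw [B.height_of_ne_zero hk]; omega

/-- Any other honest block is more than Δ away in time, so one of the two is strictly higher. -/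
lemma eq_loner_of_height_eq (hB : B.HonestRule Δ) {u v : ℝ} {k i : ℕ} (hk : k ∈ B.loners Δ u v)
    (hi : B.honest i) (h : B.height i = B.height k) : i = k := by
  by_contra hne
  have hi0 : i ≠ 0 := by
    rintro rfl
    have := height_pos (B := B) hk.1.1
    rw [B.height_zero] at h; omega
  have h1 := hk.2 i hi0 hi hne
  rcases lt_abs.1 h1 with h2 | h2
  · exact absurd h (height_lt_of_honest hB hk.1.2.1 hi0 hi (by linarith)).ne'
  · exact absurd h (height_lt_of_honest hB hi hk.1.1 hk.1.2.1 (by linarith)).ne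

/-- The parent of an honest block mined after `t` is itself credible at that mining time, so the
blockchain can be cut there and the argument repeated. -/
lemma exists_stub (hB : B.HonestRule Δ) {t : ℝ} (ht : 0 ≤ t) {r : ℝ} (hr : t ≤ r) {c : ℕ}
    (hc : B.IsCredible Δ r c) : ∃ d ∈ B.chain c, ∃ b, t ≤ b ∧ B.IsCredible Δ b d ∧
      ∀ k ∈ B.chain d, B.honest k → B.T k ≤ t := by
  induction c using Nat.strong_induction_on generalizing r with
  | _ c ih =>
    by_cases hall : ∀ k ∈ B.chain c, B.honest k → B.T k ≤ t
    · exact ⟨c, B.self_mem_chain c, r, hr, hc, hall⟩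
    · push Not at hall
      obtain ⟨k, hkc, hk, hkt⟩ := hall
      have hk0 : k ≠ 0 := by
        rintro rfl; rw [B.T_zero] at hkt; linarith
      obtain ⟨d, hd, b, hb⟩ := ih (B.parent k) ((B.parent_lt k hk0).trans_le (B.le_of_mem_chain hkc))
        hkt.le (hB k hk0 hk).1
      exact ⟨d, (B.chain_prefix hkc).subset ((B.mem_chain_of_ne_zero hk0).2 (Or.inl hd)), b, hb⟩

lemma subsingleton_loners {t u v : ℝ} :
    {k | k ∈ B.loners Δ u v ∧ t - Δ < B.T k ∧ B.T k ≤ t}.Subsingleton := by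
  rintro i ⟨hi, hi1, hi2⟩ k ⟨hk, hk1, hk2⟩
  by_contra hne
  have := hk.2 i hi.1.1 hi.1.2.1 hne
  rcases lt_abs.1 this with h | h <;> linarith

/-- If the loners outnumber the adversarial blocks by two on all intervals around `(s, t]`, then
blockchains that are credible at or after time `t` share an honest block mined during `(s, t]`. -/
theorem exists_common_honest (hB : B.HonestRule Δ) {s t : ℝ} (hs : 0 ≤ s) (hst : s ≤ t)
    (hgood : ∀ a b, 0 ≤ a → a ≤ s → t ≤ b →
      (B.adversarialBlocks a b).ncard + 2 ≤ (B.loners Δ (a + Δ) (b - Δ)).ncard)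
    {r r' : ℝ} (hr : t ≤ r) (hr' : t ≤ r') {c c' : ℕ} (hc : B.IsCredible Δ r c)
    (hc' : B.IsCredible Δ r' c') :
    ∃ k, B.honest k ∧ s < B.T k ∧ B.T k ≤ t ∧ k ∈ B.chain c ∧ k ∈ B.chain c' := by
  suffices key : ∀ d d' b b', t ≤ b → b ≤ b' → B.IsCredible Δ b d → B.IsCredible Δ b' d' →
      (∀ k ∈ B.chain d, B.honest k → B.T k ≤ t) → (∀ k ∈ B.chain d', B.honest k → B.T k ≤ t) →
      ∃ k, B.honest k ∧ s < B.T k ∧ k ∈ B.chain d ∧ k ∈ B.chain d' by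
    obtain ⟨d, hd, b, hb, hbd, hall⟩ := exists_stub hB (hs.trans hst) hr hc
    obtain ⟨d', hd', b', hb', hbd', hall'⟩ := exists_stub hB (hs.trans hst) hr' hc'
    rcases le_total b b' with h | h
    · obtain ⟨k, h1, h2, h3, h4⟩ := key d d' b b' hb h hbd hbd' hall hall'
      exact ⟨k, h1, h2, hall k h3 h1, (B.chain_prefix hd).subset h3, (B.chain_prefix hd').subset h4⟩
    · obtain ⟨k, h1, h2, h3, h4⟩ := key d' d b' b hb' h hbd' hbd hall' hall
      exact ⟨k, h1, h2, hall' k h3 h1, (B.chain_prefix hd).subset h4, (B.chain_prefix hd').subset h3⟩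
  intro d d' b b' hb hbb' hd hd' hall hall'
  by_contra! hno
  obtain ⟨e, ⟨he, hed, hed'⟩, hmax⟩ : ∃ e, (B.honest e ∧ e ∈ B.chain d ∧ e ∈ B.chain d') ∧
      ∀ k, B.honest k ∧ k ∈ B.chain d ∧ k ∈ B.chain d' → B.height k ≤ B.height e := by
    have hfin : {k | B.honest k ∧ k ∈ B.chain d ∧ k ∈ B.chain d'}.Finite :=
      (List.finite_toSet (B.chain d)).subset fun k hk => hk.2.1
    obtain ⟨e, he, hm⟩ := hfin.exists_maximalFor B.height _
      ⟨0, B.honest_zero, B.zero_mem_chain d, B.zero_mem_chain d'⟩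
    exact ⟨e, he, fun k hk => (le_total _ _).elim id (fun h => hm hk h)⟩
  have hes : B.T e ≤ s := by
    by_contra hlt
    exact hno e he (not_le.1 hlt) hed hed'
  have hg := hgood (B.T e) b' (B.T_nonneg e) hes (hb.trans hbb')
  set L := B.loners Δ (B.T e + Δ) (b' - Δ) with hL
  have hadv : ∀ k ∈ {k | k ∈ L ∧ ¬ (t - Δ < B.T k ∧ B.T k ≤ t)},
      ∃ x ∈ B.adversarialBlocks (B.T e) b', B.height x = B.height k := by
    rintro k ⟨hk, hkt⟩
    have hkh := hk.1.2.1
    have hkP := P_eq_of_honest hB hkh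
    have hek : B.height e < B.height k :=
      height_lt_of_honest hB he hk.1.1 hkh (by linarith [hk.1.2.2.1])
    have hkd' : B.height k ≤ B.height d' :=
      hd'.2 k (by rw [hkP]; exact_mod_cast hk.1.2.2.2)
    obtain ⟨x', hx', hxk'⟩ := B.exists_mem_chain_height hkd'
    have mk : ∀ {f y : ℕ} {v : ℝ}, e ∈ B.chain f → y ∈ B.chain f → B.height y = B.height k →
        B.P f ≤ (v : EReal) → v ≤ b' → ¬ B.honest y → y ∈ B.adversarialBlocks (B.T e) b' := by
      intro f y v hef hyf hy hP hv hyh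
      refine ⟨?_, hyh, B.T_lt_of_height_lt hef hyf (by omega), ?_⟩
      · rintro rfl; exact hyh B.honest_zero
      · have := ((B.T_le_P y).trans (B.P_le_of_mem_chain hyf)).trans hP
        exact (EReal.coe_le_coe_iff.1 this).trans hv
    by_cases hxh' : B.honest x'
    · have hx'k := eq_loner_of_height_eq hB hk hxh' hxk'
      subst hx'k
      have h1 := hall' x' hx' hxh'
      have h2 : B.T x' ≤ t - Δ := by
        by_contra h; exact hkt ⟨not_le.1 h, h1⟩
      have hkd : B.height x' ≤ B.height d :=
        hd.2 x' (by rw [hkP]; exact_mod_cast (by linarith : B.T x' ≤ b - Δ))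
      obtain ⟨x, hx, hxk⟩ := B.exists_mem_chain_height hkd
      refine ⟨x, mk hed hx hxk hd.1 hbb' fun hxh => ?_, hxk⟩
      have hxx' := eq_loner_of_height_eq hB hk hxh hxk
      subst hxx'
      exact absurd (hmax x ⟨hxh, hx, hx'⟩) (not_le.2 hek)
    · exact ⟨x', mk hed' hx' hxk' hd'.1 le_rfl hxh', hxk'⟩
  choose! f hf hfh using hadv
  have h1 : {k | k ∈ L ∧ ¬ (t - Δ < B.T k ∧ B.T k ≤ t)}.ncard ≤
      (B.adversarialBlocks (B.T e) b').ncard := by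
    refine Set.ncard_le_ncard_of_injOn f hf ?_ (B.finite_adversarialBlocks _ _)
    intro i hi k hk hik
    refine eq_loner_of_height_eq hB hk.1 hi.1.1.2.1 ?_
    rw [← hfh i hi, ← hfh k hk, hik]
  -- A loner mined in `(t - Δ, t]` may lie on `d'` while `d` is too low to reach it. This exception
  -- is why the surplus has to be two.
  have h2 : {k | k ∈ L ∧ (t - Δ < B.T k ∧ B.T k ≤ t)}.ncard ≤ 1 :=
    (Set.ncard_le_one ((B.finite_loners _ _ _).subset fun k hk => hk.1)).2
      fun a ha b hb => subsingleton_loners ha hb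
  have h3 : L.ncard ≤ {k | k ∈ L ∧ ¬ (t - Δ < B.T k ∧ B.T k ≤ t)}.ncard +
      {k | k ∈ L ∧ (t - Δ < B.T k ∧ B.T k ≤ t)}.ncard := by
    refine le_trans (Set.ncard_le_ncard ?_ ?_) (Set.ncard_union_le _ _)
    · intro k hk
      by_cases h : t - Δ < B.T k ∧ B.T k ≤ t
      · exact Or.inr ⟨hk, h⟩
      · exact Or.inl ⟨hk, h⟩
    · exact (B.finite_loners Δ (B.T e + Δ) (b' - Δ)).subset
        (Set.union_subset (fun k hk => hk.1) (fun k hk => hk.1))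
  omega

end HonestRule

/-! ### Publication times of heights and inherited votes. -/

lemma firstPublished_mono {l h : ℕ} (hlh : l ≤ h) : B.firstPublished l ≤ B.firstPublished h := by
  refine le_iInf₂ fun k hk => ?_
  obtain ⟨a, ha, hal⟩ := B.exists_mem_chain_height (hlh.trans hk.ge)
  exact (iInf₂_le a hal).trans (B.P_le_of_mem_chain ha)

lemma firstPublished_nonneg (h : ℕ) : 0 ≤ B.firstPublished h := by
  refine le_iInf₂ fun k _ => le_trans ?_ (B.T_le_P k)
  exact_mod_cast B.T_nonneg k

/-- Blockchain `k` is a prefix of blockchain `c`, and only the first vote counts. -/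
lemma chainVote_eq_of_mem {vote : ℕ → ℕ → Option ℕ} {k c l : ℕ} (hk : k ∈ B.chain c)
    (h : (B.chainVote vote k l).isSome) : B.chainVote vote c l = B.chainVote vote k l := by
  obtain ⟨rest, hrest⟩ := B.chain_prefix hk
  unfold chainVote at *
  rw [← hrest, List.findSome?_append]
  obtain ⟨p, hp⟩ := Option.isSome_iff_exists.1 h
  rw [hp]; rfl

end BlockTree

/-! ### Chernoff bounds and isolated arrivals in independent cells. -/

section Tails

lemma exp_le_one_add_add_sq {x : ℝ} (h : |x| ≤ 1) : Real.exp x ≤ 1 + x + x ^ 2 := by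
  have := Real.abs_exp_sub_one_sub_id_le h
  linarith [le_abs_self (Real.exp x - 1 - x)]

/-- Chernoff's bound for the upper tail of the Poisson distribution. -/
lemma one_sub_poisson_cdf_le {l θ : ℝ} (hl : 0 ≤ l) (hθ : 0 ≤ θ) (a : ℕ) :
    1 - Real.exp (-l) * ∑ i ∈ Finset.range (a + 1), l ^ i / (i.factorial : ℝ) ≤
      Real.exp (l * (Real.exp θ - 1) - θ * (a + 1)) := by
  have hs : ∀ x : ℝ, HasSum (fun i : ℕ => x ^ i / (i.factorial : ℝ)) (Real.exp x) := fun x => by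
    rw [Real.exp_eq_exp_ℝ]; exact NormedSpace.expSeries_div_hasSum_exp x
  have h1 := (hasSum_nat_add_iff' (a + 1)).2 (hs l)
  have h2 := ((hasSum_nat_add_iff' (a + 1)).2 (hs (l * Real.exp θ))).mul_left
    (Real.exp (-(θ * (a + 1))))
  have h3 := hasSum_le (fun i => ?_) h1 h2
  · have h4 : 0 ≤ ∑ i ∈ Finset.range (a + 1), (l * Real.exp θ) ^ i / (i.factorial : ℝ) := by
      positivity
    have h5 := h3.trans (mul_le_mul_of_nonneg_left (sub_le_self _ h4) (Real.exp_pos _).le)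
    have h6 := mul_le_mul_of_nonneg_left h5 (Real.exp_pos (-l)).le
    rw [mul_sub, ← Real.exp_add, neg_add_cancel, Real.exp_zero, ← Real.exp_add, ← Real.exp_add]
      at h6
    refine h6.trans_eq ?_
    congr 1; ring
  · rw [mul_pow, ← mul_div_assoc]
    refine div_le_div_of_nonneg_right ?_ (by positivity)
    -- Only terms of index at least `a + 1` remain in the tail, so the exponential weight is at
    -- least 1.
    have h7 : 1 ≤ Real.exp (-(θ * (a + 1))) * Real.exp θ ^ (i + (a + 1)) := by
      rw [← Real.exp_nat_mul, ← Real.exp_add]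
      refine Real.one_le_exp ?_
      push_cast
      have : 0 ≤ (i : ℝ) * θ := by positivity
      linarith
    have := mul_le_mul_of_nonneg_left h7 (pow_nonneg hl (i + (a + 1)))
    linarith

variable {Ω : Type*} [MeasurableSpace Ω] {Pr : Measure Ω}

/-- Functions of consecutive disjoint blocks of `M` variables of an independent sequence have
multiplicative moment generating functions. -/
lemma mgf_sum_block {ξ : ℕ → Ω → ℕ} (hind : iIndepFun ξ Pr) (hmeas : ∀ i, Measurable (ξ i))
    {M : ℕ} (f : (Fin M → ℕ) → ℝ) (a : ℕ) (θ : ℝ) (K : ℕ) :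
    mgf (fun ω => ∑ k ∈ Finset.range K, f fun i => ξ (a + k * M + i) ω) Pr θ =
      ∏ k ∈ Finset.range K, mgf (fun ω => f fun i => ξ (a + k * M + i) ω) Pr θ := by
  have : IsProbabilityMeasure Pr := hind.isProbabilityMeasure
  have hX : ∀ k, Measurable fun ω => f fun i => ξ (a + k * M + i) ω := fun k =>
    (measurable_of_countable f).comp (measurable_pi_lambda _ fun i => hmeas _)
  induction K with
  | zero => simp [mgf]
  | succ K ih =>
    simp_rw [Finset.prod_range_succ, Finset.sum_range_succ]
    rw [← ih]
    have hI := hind.indepFun_finset (Finset.range (a + K * M))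
      (Finset.Ico (a + K * M) (a + K * M + M)) (by
        rw [Finset.disjoint_left]; intro x hx hx'
        simp at hx hx'; omega) hmeas
    -- The padding value 0 is never read: the first `K` blocks only use indices below `a + K * M`.
    let ext : (Finset.range (a + K * M) → ℕ) → ℕ → ℕ := fun z i =>
      if h : i ∈ Finset.range (a + K * M) then z ⟨i, h⟩ else 0
    have hI2 := hI.comp
      (φ := fun z => ∑ k ∈ Finset.range K, f fun i => ext z (a + k * M + i))
      (ψ := fun z => f fun i => z ⟨a + K * M + i, by have := i.2; simp⟩)
      (measurable_of_countable _) (measurable_of_countable _)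
    have h1 : ((fun z => ∑ k ∈ Finset.range K, f fun i => ext z (a + k * M + i)) ∘
        fun ω (i : Finset.range (a + K * M)) => ξ i ω) =
        fun ω => ∑ k ∈ Finset.range K, f fun i => ξ (a + k * M + i) ω := by
      funext ω
      simp only [Function.comp]
      refine Finset.sum_congr rfl fun k hk => ?_
      congr 1; funext i
      have hk' : k + 1 ≤ K := Finset.mem_range.1 hk
      have : (k + 1) * M ≤ K * M := Nat.mul_le_mul_right M hk'
      have hi := i.2
      rw [Nat.add_mul] at this
      have : a + k * M + i ∈ Finset.range (a + K * M) := Finset.mem_range.2 (by omega)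
      simp only [ext, this, dif_pos]
    rw [h1] at hI2
    exact IndepFun.mgf_add' hI2
      (Finset.measurable_sum _ fun k _ => hX k).aestronglyMeasurable (hX K).aestronglyMeasurable

/-- A pattern of `3n` cell counts contains an isolated arrival: one of the middle `n` cells has one
arrival, and the `n` cells before it and the `n` cells after it have none. -/
def Isolated (n : ℕ) (z : Fin (3 * n) → ℕ) : Prop :=
  ∃ i < n, ∀ j : Fin (3 * n), i ≤ j → j ≤ i + 2 * n → z j = if (j : ℕ) = i + n then 1 else 0

open Classical in
-- The events for different positions of the arrival are disjoint, and each prescribes one arrival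
-- in one cell and none in 2n others.
lemma measure_isolated {ξ : ℕ → Ω → ℕ} (hind : iIndepFun ξ Pr) (hmeas : ∀ i, Measurable (ξ i))
    {r : ℝ} (h0 : ∀ i, Pr {ω | ξ i ω = 0} = ENNReal.ofReal (Real.exp (-r)))
    (h1 : ∀ i, Pr {ω | ξ i ω = 1} = ENNReal.ofReal (r * Real.exp (-r))) (hr : 0 ≤ r)
    (n a : ℕ) :
    Pr.real {ω | Isolated n fun i => ξ (a + i) ω} = n * (r * Real.exp (-((2 * n + 1) * r))) := by
  have : IsProbabilityMeasure Pr := hind.isProbabilityMeasure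
  let D : ℕ → Set Ω := fun i =>
    ⋂ j ∈ Finset.Icc (a + i) (a + i + 2 * n), ξ j ⁻¹' {if j = a + i + n then 1 else 0}
  have hDm : ∀ i, MeasurableSet (D i) := fun i =>
    Finset.measurableSet_biInter _ fun j _ => hmeas j (MeasurableSet.of_discrete)
  have hD : ∀ i, Pr (D i) = ENNReal.ofReal (r * Real.exp (-((2 * n + 1) * r))) := by
    intro i
    rw [hind.measure_inter_preimage_eq_mul _ (fun _ _ => MeasurableSet.of_discrete)]
    have hmem : a + i + n ∈ Finset.Icc (a + i) (a + i + 2 * n) := by simp; omega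
    rw [← Finset.mul_prod_erase _ _ hmem]
    have e1 : Pr (ξ (a + i + n) ⁻¹' {if a + i + n = a + i + n then 1 else 0}) =
        ENNReal.ofReal (r * Real.exp (-r)) := by
      rw [← h1 (a + i + n), if_pos rfl]; rfl
    have e2 : ∀ j ∈ (Finset.Icc (a + i) (a + i + 2 * n)).erase (a + i + n),
        Pr (ξ j ⁻¹' {if j = a + i + n then 1 else 0}) = ENNReal.ofReal (Real.exp (-r)) := by
      intro j hj
      rw [← h0 j, if_neg (Finset.ne_of_mem_erase hj)]; rfl
    rw [e1, Finset.prod_congr rfl e2, Finset.prod_const, Finset.card_erase_of_mem hmem,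
      ← ENNReal.ofReal_pow (Real.exp_pos _).le, ← ENNReal.ofReal_mul (by positivity),
      ← Real.exp_nat_mul, mul_assoc, ← Real.exp_add]
    congr 3
    simp only [Nat.card_Icc]
    rw [show a + i + 2 * n + 1 - (a + i) - 1 = 2 * n by omega]
    push_cast; ring
  have hU : {ω | Isolated n fun i => ξ (a + i) ω} = ⋃ i ∈ Finset.range n, D i := by
    ext ω
    simp only [Isolated, Set.mem_ofPred_eq, Set.mem_iUnion, Finset.mem_range, D, Set.mem_iInter,
      Finset.mem_Icc, Set.mem_preimage, Set.mem_singleton_iff, exists_prop]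
    refine exists_congr fun i => and_congr_right fun hi => ⟨fun h j hj => ?_, fun h j hj hj' => ?_⟩
    · have := h ⟨j - a, by omega⟩ (by simp; omega) (by simp; omega)
      simp only at this
      rw [show a + (j - a) = j by omega] at this
      rw [this]
      congr 1
      exact propext (by omega)
    · rw [h (a + j) (by omega)]
      congr 1
      exact propext (by omega)
  -- The cell holding the arrival for `i` is required to be empty for `j`, because both positions
  -- are among the middle `n` cells.
  have hdisj : (↑(Finset.range n) : Set ℕ).PairwiseDisjoint D := by
    intro i hi j hj hij
    simp only [Finset.coe_range, Set.mem_Iio] at hi hj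
    rw [Function.onFun, Set.disjoint_left]
    intro ω hωi hωj
    simp only [D, Set.mem_iInter, Finset.mem_Icc, Set.mem_preimage, Set.mem_singleton_iff]
      at hωi hωj
    have e1 := hωi (a + i + n) (by omega)
    have e2 := hωj (a + i + n) (by omega)
    rw [if_pos rfl] at e1
    rw [e1, if_neg (by omega)] at e2
    omega
  rw [hU, measureReal_def, measure_biUnion_finset hdisj fun i _ => hDm i,
    Finset.sum_congr rfl fun i _ => hD i, Finset.sum_const, Finset.card_range, nsmul_eq_mul,
    ENNReal.toReal_mul, ENNReal.toReal_natCast, ENNReal.toReal_ofReal (by positivity)]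

/-- The Bernoulli moment generating function is compared with the Poisson one through 1 + x ≤ eˣ. -/
lemma mgf_indicator_le [IsProbabilityMeasure Pr] {A : Set Ω} (hA : MeasurableSet A) (θ : ℝ) :
    mgf (A.indicator 1) Pr θ ≤ Real.exp (Pr.real A * (Real.exp θ - 1)) := by
  have h : (fun ω => Real.exp (θ * A.indicator (1 : Ω → ℝ) ω)) =
      fun ω => 1 + A.indicator (fun _ => Real.exp θ - 1) ω := by
    funext ω
    by_cases hω : ω ∈ A <;> simp [hω]
  rw [mgf, h, integral_add (integrable_const _) ((integrable_const _).indicator hA),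
    integral_indicator_const _ hA]
  simp only [integral_const, probReal_univ, smul_eq_mul, one_mul]
  linarith [Real.add_one_le_exp (Pr.real A * (Real.exp θ - 1))]

open Classical in
/-- Lower tail of the number of blocks of `3n` cells that contain an isolated arrival. -/
lemma isolated_tail {ξ : ℕ → Ω → ℕ} (hind : iIndepFun ξ Pr) (hmeas : ∀ i, Measurable (ξ i))
    {r : ℝ} (h0 : ∀ i, Pr {ω | ξ i ω = 0} = ENNReal.ofReal (Real.exp (-r)))
    (h1 : ∀ i, Pr {ω | ξ i ω = 1} = ENNReal.ofReal (r * Real.exp (-r))) (hr : 0 ≤ r)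
    (n a K : ℕ) {δ q : ℝ} (hδ : 0 ≤ δ) (hδ1 : δ ≤ 1)
    (hq : q = n * (r * Real.exp (-((2 * n + 1) * r)))) :
    Pr.real {ω | (∑ k ∈ Finset.range K,
        if Isolated n (fun i => ξ (a + k * (3 * n) + i) ω) then (1 : ℝ) else 0) ≤
          (1 - δ) * (K * q)} ≤ Real.exp (-(δ ^ 2 / 4 * (K * q))) := by
  have : IsProbabilityMeasure Pr := hind.isProbabilityMeasure
  have hq0 : 0 ≤ q := by rw [hq]; positivity
  let f : (Fin (3 * n) → ℕ) → ℝ := fun z => if Isolated n z then 1 else 0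
  have hm := mgf_sum_block hind hmeas f a (-(δ / 2)) K
  have hX : ∀ k, Measurable fun ω => f fun i => ξ (a + k * (3 * n) + i) ω := fun k =>
    (measurable_of_countable f).comp (measurable_pi_lambda _ fun i => hmeas _)
  have hle : ∀ k ∈ Finset.range K, mgf (fun ω => f fun i => ξ (a + k * (3 * n) + i) ω) Pr
      (-(δ / 2)) ≤ Real.exp (q * (Real.exp (-(δ / 2)) - 1)) := by
    intro k _
    have hA : MeasurableSet {ω | Isolated n fun i => ξ (a + k * (3 * n) + i) ω} :=
      (measurable_pi_lambda (fun ω (i : Fin (3 * n)) => ξ (a + k * (3 * n) + i) ω)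
        fun i => hmeas _) (MeasurableSet.of_discrete (s := {z | Isolated n z}))
    have := mgf_indicator_le (Pr := Pr) hA (-(δ / 2))
    rw [measure_isolated hind hmeas h0 h1 hr, ← hq] at this
    convert this using 2
    funext ω
    simp [f, Set.indicator_apply]
  have hint : Integrable (fun ω => Real.exp (-(δ / 2) * ∑ k ∈ Finset.range K,
      f fun i => ξ (a + k * (3 * n) + i) ω)) Pr := by
    refine Integrable.of_bound (C := 1) ?_ (ae_of_all _ fun ω => ?_)
    · exact ((Finset.measurable_sum _ fun k _ => hX k).const_mul _).exp.aestronglyMeasurable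
    · rw [Real.norm_eq_abs, abs_of_pos (Real.exp_pos _), Real.exp_le_one_iff]
      have : 0 ≤ ∑ k ∈ Finset.range K, f fun i => ξ (a + k * (3 * n) + i) ω :=
        Finset.sum_nonneg fun k _ => by simp only [f]; split_ifs <;> norm_num
      nlinarith
  refine (measure_le_le_exp_mul_mgf ((1 - δ) * (K * q)) (by linarith : -(δ / 2) ≤ 0) hint).trans ?_
  rw [hm]
  have hprod := Finset.prod_le_prod (fun k _ => mgf_nonneg) hle
  rw [Finset.prod_const, Finset.card_range, ← Real.exp_nat_mul] at hprod
  refine (mul_le_mul_of_nonneg_left hprod (Real.exp_pos _).le).trans ?_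
  rw [← Real.exp_add, Real.exp_le_exp]
  -- With parameter -δ/2 the exponent is at most Kq(δ(1 - δ)/2 - δ/2 + δ²/4) = -δ²Kq/4.
  have he := exp_le_one_add_add_sq (x := -(δ / 2)) (by rw [abs_le]; constructor <;> linarith)
  have hKq : 0 ≤ K * q := by positivity
  have := mul_le_mul_of_nonneg_left he hKq
  nlinarith

end Tails

/-! ### From isolated arrivals to loners. -/

namespace BlockTree

variable (B : BlockTree)

/-- An isolated arrival in the pattern of honest arrivals over cells of length `Δ / n` is a
loner. -/
lemma exists_loner_of_isolated {Δ u τ : ℝ} (hτ : 0 < τ) {n a : ℕ} (hn : n * τ = Δ)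
    (h : Isolated n fun i : Fin (3 * n) => B.honestCount (u + (a + i + 1 : ℕ) * τ) -
      B.honestCount (u + (a + i : ℕ) * τ)) :
    ∃ k, k ∈ B.loners Δ (u + (a + n : ℕ) * τ) (u + (a + 2 * n : ℕ) * τ) := by
  obtain ⟨i, hi, h⟩ := h
  have hcell : ∀ c : ℕ, i ≤ c → c ≤ i + 2 * n →
      (B.honestBlocks (u + (a + c : ℕ) * τ) (u + (a + c + 1 : ℕ) * τ)).ncard =
        if c = i + n then 1 else 0 := by
    intro c hc hc'
    rw [B.ncard_honestBlocks (by push_cast; nlinarith)]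
    exact h ⟨c, by omega⟩ hc hc'
  obtain ⟨k, hk⟩ := Set.ncard_eq_one.1 ((hcell (i + n) (by omega) (by omega)).trans (if_pos rfl))
  have hkm : k ∈ B.honestBlocks (u + (a + (i + n) : ℕ) * τ) (u + (a + (i + n) + 1 : ℕ) * τ) := by
    rw [hk]; rfl
  have hmono : ∀ c d : ℕ, c ≤ d → u + c * τ ≤ u + d * τ := fun c d hcd => by
    have : (c : ℝ) ≤ d := by exact_mod_cast hcd
    nlinarith
  refine ⟨k, ⟨hkm.1, hkm.2.1, (hmono _ _ (by omega)).trans_lt hkm.2.2.1,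
    hkm.2.2.2.trans (hmono _ _ (by omega))⟩, fun l hl0 hl hlk => ?_⟩
  by_contra hd
  obtain ⟨hd1, hd2⟩ := abs_le.1 (not_lt.1 hd)
  have hlow : u + (a + i : ℕ) * τ < B.T l := by
    have := hkm.2.2.1
    push_cast at this ⊢
    linarith
  have hup : B.T l ≤ u + (a + i + (2 * n + 1) : ℕ) * τ := by
    have := hkm.2.2.2
    push_cast at this ⊢
    linarith
  -- The least such `c` locates the cell containing the mining time of `l`; the pattern leaves no
  -- room for a second arrival there.
  have hex : ∃ c, B.T l ≤ u + (a + i + (c + 1) : ℕ) * τ := ⟨2 * n, hup⟩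
  classical
  have hf := Nat.find_spec hex
  have hf2 : Nat.find hex ≤ 2 * n := Nat.find_min' hex hup
  have hf3 : u + (a + i + Nat.find hex : ℕ) * τ < B.T l := by
    rcases Nat.eq_zero_or_pos (Nat.find hex) with h0 | h0
    · rw [h0]; exact hlow
    · have := Nat.find_min hex (m := Nat.find hex - 1) (by omega)
      rw [show Nat.find hex - 1 + 1 = Nat.find hex by omega] at this
      exact not_le.1 this
  set c := Nat.find hex
  have hlm : l ∈ B.honestBlocks (u + (a + (i + c) : ℕ) * τ) (u + (a + (i + c) + 1 : ℕ) * τ) :=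
    ⟨hl0, hl, by rw [← add_assoc]; exact hf3, by rw [← add_assoc, add_assoc (a + i)]; exact hf⟩
  have hc1 := hcell (i + c) (by omega) (by omega)
  by_cases hcn : c = n
  · rw [hcn, hk] at hlm
    exact hlk hlm
  · rw [if_neg (by omega), Set.ncard_eq_zero (B.finite_honestBlocks _ _)] at hc1
    rw [hc1] at hlm
    exact hlm

open Classical in
/-- Blocks of cells with isolated arrivals are at most as many as the loners. -/
lemma sum_isolated_le {Δ u τ : ℝ} (hτ : 0 < τ) {n : ℕ} (hn : n * τ = Δ) (K : ℕ) :
    ∑ b ∈ Finset.range K, (if Isolated n (fun i : Fin (3 * n) =>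
      B.honestCount (u + (b * n + i + 1 : ℕ) * τ) - B.honestCount (u + (b * n + i : ℕ) * τ))
        then 1 else 0) ≤ (B.loners Δ (u + Δ) (u + Δ + K * Δ)).ncard := by
  have hΔ : 0 ≤ Δ := by rw [← hn]; positivity
  rw [← Finset.card_filter, ← Set.ncard_coe_finset]
  have hex : ∀ b ∈ Finset.filter (fun b => Isolated n (fun i : Fin (3 * n) =>
      B.honestCount (u + (b * n + i + 1 : ℕ) * τ) - B.honestCount (u + (b * n + i : ℕ) * τ)))
        (Finset.range K), ∃ k, k ∈ B.loners Δ (u + Δ + b * Δ) (u + Δ + (b + 1) * Δ) := by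
    intro b hb
    obtain ⟨k, hk⟩ := B.exists_loner_of_isolated hτ hn (Finset.mem_filter.1 hb).2
    refine ⟨k, ?_⟩
    have e1 : u + Δ + b * Δ = u + (b * n + n : ℕ) * τ := by rw [← hn]; push_cast; ring
    have e2 : u + Δ + (b + 1) * Δ = u + (b * n + 2 * n : ℕ) * τ := by rw [← hn]; push_cast; ring
    rw [e1, e2]
    exact hk
  choose! f hf using hex
  refine Set.ncard_le_ncard_of_injOn f ?_ ?_ (B.finite_loners _ _ _)
  · intro b hb
    obtain ⟨⟨h1, h2, h3, h4⟩, h5⟩ := hf b hb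
    have hbK : (b : ℝ) + 1 ≤ K := by exact_mod_cast Finset.mem_range.1 (Finset.mem_filter.1 hb).1
    refine ⟨⟨h1, h2, ?_, h4.trans ?_⟩, h5⟩
    · have : 0 ≤ b * Δ := by positivity
      linarith
    · nlinarith
  · intro b hb c hc hbc
    obtain ⟨⟨-, -, h3, h4⟩, -⟩ := hf b hb
    obtain ⟨⟨-, -, h3', h4'⟩, -⟩ := hf c hc
    rw [hbc] at h3 h4
    have hb1 : ∀ b c : ℕ, u + Δ + b * Δ < B.T (f c) → B.T (f c) ≤ u + Δ + (c + 1) * Δ → b ≤ c := by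
      intro b c h h'
      by_contra hlt
      have : (c : ℝ) + 1 ≤ b := by exact_mod_cast not_le.1 hlt
      nlinarith
    exact le_antisymm (hb1 _ _ h3 h4') (by
      rw [← hbc] at h4 h3' h4'
      exact hb1 _ _ h3' h4)

end BlockTree

/-! ### Tail bounds for loners and adversarial blocks. -/

section

variable {Ω : Type*} [MeasurableSpace Ω] {Pr : Measure Ω} {m : ℕ} {Δ α β : ℝ}
  {X : Ω → Outcome m Δ}

/-- Windows of 3n cells start every n cells, so those with starting numbers in one residue class mod
3 are disjoint and hence independent. -/
lemma sum_range_three_mul {M : Type*} [AddCommMonoid M] (f : ℕ → M) (K : ℕ) :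
    ∑ b ∈ Finset.range (3 * K), f b =
      ∑ c ∈ Finset.range 3, ∑ k ∈ Finset.range K, f (3 * k + c) := by
  induction K with
  | zero => simp
  | succ K ih =>
    rw [show 3 * (K + 1) = 3 * K + 1 + 1 + 1 by ring]
    simp only [Finset.sum_range_succ, ih, Finset.sum_range_zero]
    simp only [zero_add, add_zero]
    abel

open Classical in
/-- Lower tail of the number of loners. -/
lemma loners_tail [IsProbabilityMeasure Pr] (hX : IsPrismSystem Pr α β X) (hα : 0 ≤ α)
    (hΔ : 0 < Δ) (j : Fin (m + 1)) {u : ℝ} (hu : 0 ≤ u) {n : ℕ} (hn : 0 < n) (K : ℕ) {δ q : ℝ}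
    (hδ : 0 ≤ δ) (hδ1 : δ ≤ 1) (hq : q = α * Δ * g α Δ ^ 2 * Real.exp (-(α * Δ / n))) :
    ∃ E : Set Ω, MeasurableSet E ∧ Pr.real E ≤ 3 * Real.exp (-(δ ^ 2 / 4 * (K * q))) ∧
      ∀ ω, ω ∉ E → 3 * ((1 - δ) * (K * q)) <
        (((X ω).tree j).loners Δ (u + Δ) (u + Δ + (3 * K : ℕ) * Δ)).ncard := by
  have hn' : (0 : ℝ) < n := by exact_mod_cast hn
  let x : ℕ → ℝ≥0 := fun k => ⟨u + k * (Δ / n), by positivity⟩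
  have hxv : ∀ k, (x k : ℝ) = u + k * (Δ / n) := fun _ => rfl
  have hx : StrictMono x := strictMono_nat_of_lt_succ fun k => by
    rw [← NNReal.coe_lt_coe, hxv, hxv]
    have : 0 < Δ / n := by positivity
    push_cast; linarith
  let ξ : ℕ → Ω → ℕ := fun k ω =>
    ((X ω).tree j).honestCount (x (k + 1)) - ((X ω).tree j).honestCount (x k)
  have hind : iIndepFun ξ Pr := (hX.indep_increments j).nat hx.monotone
  have hmeas : ∀ k, Measurable (ξ k) := fun k =>
    (hX.measurable_honest j (x (k + 1))).sub (hX.measurable_honest j (x k))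
  set r := α * Δ / n with hr
  have hr0 : 0 ≤ r := by positivity
  have hlaw : ∀ k, HasLaw (ξ k) (poissonMeasure r.toNNReal) Pr := fun k => by
    have := hX.poisson_increments j (x k) (x (k + 1)) (hx (Nat.lt_succ_self k))
    convert this using 3
    rw [hxv, hxv, hr]
    push_cast; ring
  have hpm : ∀ k c, Pr {ω | ξ k ω = c} =
      ENNReal.ofReal (Real.exp (-r) * r ^ c / (c.factorial : ℝ)) := fun k c => by
    have := (hlaw k).measure_eq (p := fun z => z = c) MeasurableSet.of_discrete
    rw [this]
    have e : {z : ℕ | z = c} = {c} := rfl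
    rw [e, poissonMeasure_singleton, Real.coe_toNNReal _ hr0]
  have h0 : ∀ k, Pr {ω | ξ k ω = 0} = ENNReal.ofReal (Real.exp (-r)) := fun k => by
    rw [hpm]; simp
  have h1 : ∀ k, Pr {ω | ξ k ω = 1} = ENNReal.ofReal (r * Real.exp (-r)) := fun k => by
    rw [hpm]; simp [mul_comm]
  have hq' : q = n * (r * Real.exp (-((2 * n + 1) * r))) := by
    rw [hq, g, ← Real.exp_nat_mul, mul_assoc (α * Δ), ← Real.exp_add, ← mul_assoc, hr]
    congr 1
    · field_simp
    · congr 1; field_simp; push_cast; ring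
  let S : ℕ → Ω → ℝ := fun a ω => ∑ k ∈ Finset.range K,
    if Isolated n (fun i => ξ (a + k * (3 * n) + i) ω) then (1 : ℝ) else 0
  have hSm : ∀ a, Measurable (S a) := fun a => Finset.measurable_sum _ fun k _ =>
    (measurable_of_countable (fun z : Fin (3 * n) → ℕ => if Isolated n z then (1 : ℝ) else 0)).comp
      (measurable_pi_lambda _ fun i => hmeas _)
  refine ⟨⋃ c ∈ Finset.range 3, {ω | S (c * n) ω ≤ (1 - δ) * (K * q)}, ?_, ?_, ?_⟩
  · exact Finset.measurableSet_biUnion _ fun c _ => measurableSet_le (hSm _) measurable_const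
  · refine (measureReal_biUnion_finset_le _ _).trans ?_
    refine (Finset.sum_le_sum fun c _ =>
      isolated_tail hind hmeas h0 h1 hr0 n (c * n) K hδ hδ1 hq').trans ?_
    simp
  · intro ω hω
    simp only [Set.mem_iUnion, not_exists, Set.mem_ofPred_eq, not_le] at hω
    have hsum := ((X ω).tree j).sum_isolated_le (Δ := Δ) (u := u) (τ := Δ / n) (by positivity)
      (n := n) (by field_simp) (3 * K)
    have hcast : (∑ b ∈ Finset.range (3 * K), (if Isolated n (fun i : Fin (3 * n) =>
        ((X ω).tree j).honestCount (u + (b * n + i + 1 : ℕ) * (Δ / n)) -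
        ((X ω).tree j).honestCount (u + (b * n + i : ℕ) * (Δ / n))) then (1 : ℝ) else 0)) ≤
        (((X ω).tree j).loners Δ (u + Δ) (u + Δ + (3 * K : ℕ) * Δ)).ncard := by
      exact_mod_cast hsum
    rw [sum_range_three_mul] at hcast
    refine lt_of_lt_of_le ?_ hcast
    calc 3 * ((1 - δ) * (K * q)) = ∑ c ∈ Finset.range 3, (1 - δ) * (K * q) := by simp
      _ < ∑ c ∈ Finset.range 3, S (c * n) ω :=
        Finset.sum_lt_sum_of_nonempty ⟨0, by simp⟩ fun c hc => hω c hc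
      _ = _ := by
        refine Finset.sum_congr rfl fun c _ => Finset.sum_congr rfl fun k _ => ?_
        rw [show c * n + k * (3 * n) = (3 * k + c) * n by ring]
        rfl

/-- Upper tail of the number of adversarial blocks. -/
lemma adversarial_tail [IsProbabilityMeasure Pr] (hX : IsPrismSystem Pr α β X) (hβ : 0 ≤ β)
    (j : Fin (m + 1)) {u v θ y : ℝ} (hu : 0 ≤ u) (huv : u < v) (hθ : 0 ≤ θ) (hy : 0 ≤ y) :
    ∃ E : Set Ω, MeasurableSet E ∧
      Pr.real E ≤ Real.exp (β * (v - u) * (Real.exp θ - 1) - θ * y) ∧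
      ∀ ω, ω ∉ E → ((((X ω).tree j).adversarialBlocks u v).ncard : ℝ) ≤ y := by
  lift u to ℝ≥0 using hu
  lift v to ℝ≥0 using (u.2.trans huv.le)
  have huv' : u < v := by exact_mod_cast huv
  set G := {ω | ((X ω).tree j).adversarialCount v - ((X ω).tree j).adversarialCount u ≤ ⌊y⌋₊}
  have hG : MeasurableSet G := measurableSet_le
    ((hX.measurable_adversarial j v).sub (hX.measurable_adversarial j u)) measurable_const
  refine ⟨Gᶜ, hG.compl, ?_, fun ω hω => ?_⟩
  · have hb := hX.adversarial_bound j u v ⌊y⌋₊ huv'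
    rw [ENNReal.ofReal_le_iff_le_toReal (measure_ne_top _ _)] at hb
    rw [measureReal_compl hG, probReal_univ]
    have hc := one_sub_poisson_cdf_le (l := β * (v - u)) (by
      have : (0 : ℝ) ≤ v - u := by linarith
      positivity) hθ ⌊y⌋₊
    refine (sub_le_sub_left hb 1).trans (hc.trans (Real.exp_le_exp.2 ?_))
    have := mul_le_mul_of_nonneg_left (Nat.lt_floor_add_one y).le hθ
    linarith
  · have hω' : ω ∈ G := not_not.1 hω
    rw [BlockTree.ncard_adversarialBlocks _ huv.le]
    exact (Nat.cast_le.2 hω').trans (Nat.floor_le hy)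

end

/-! ### Surplus of loners on all intervals around a given one. -/

namespace BlockTree

variable (B : BlockTree)

lemma loners_mono {Δ u v u' v' : ℝ} (hu : u' ≤ u) (hv : v ≤ v') :
    B.loners Δ u v ⊆ B.loners Δ u' v' := fun _ hk =>
  ⟨⟨hk.1.1, hk.1.2.1, hu.trans_lt hk.1.2.2.1, hk.1.2.2.2.trans hv⟩, hk.2⟩

lemma adversarialBlocks_mono {u v u' v' : ℝ} (hu : u' ≤ u) (hv : v ≤ v') :
    B.adversarialBlocks u v ⊆ B.adversarialBlocks u' v' := fun _ hk =>
  ⟨hk.1, hk.2.1, hu.trans_lt hk.2.2.1, hk.2.2.2.trans hv⟩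

end BlockTree

section

variable {Ω : Type*} [MeasurableSpace Ω] {Pr : Measure Ω} {m : ℕ} {Δ α β δ : ℝ}
  {X : Ω → Outcome m Δ}

/-- A union bound over a geometric sequence of exceptional events. -/
lemma exists_union_of_geometric [IsProbabilityMeasure Pr] {A r : ℝ} (hA : 0 ≤ A) (hr : 0 ≤ r)
    (hr1 : r < 1) {Q : ℕ → Ω → Prop}
    (h : ∀ i, ∃ E : Set Ω, MeasurableSet E ∧ Pr.real E ≤ A * r ^ i ∧ ∀ ω, ω ∉ E → Q i ω) :
    ∃ E : Set Ω, MeasurableSet E ∧ Pr.real E ≤ A / (1 - r) ∧ ∀ ω, ω ∉ E → ∀ i, Q i ω := by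
  choose E hE hPr hQ using h
  refine ⟨⋃ i, E i, MeasurableSet.iUnion hE, ?_, fun ω hω i => hQ i ω fun hi =>
    hω (Set.mem_iUnion.2 ⟨i, hi⟩)⟩
  have hs : HasSum (fun i => A * r ^ i) (A / (1 - r)) := by
    rw [div_eq_mul_inv]
    exact (hasSum_geometric_of_lt_one hr hr1).mul_left A
  have h1 : Pr (⋃ i, E i) ≤ ENNReal.ofReal (A / (1 - r)) := by
    refine (measure_iUnion_le _).trans ?_
    rw [← hs.tsum_eq, ENNReal.ofReal_tsum_of_nonneg (fun i => by positivity) hs.summable]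
    refine ENNReal.tsum_le_tsum fun i => ?_
    rw [← ofReal_measureReal]
    exact ENNReal.ofReal_le_ofReal (hPr i)
  exact ENNReal.toReal_le_of_le_ofReal (div_nonneg hA (by linarith)) h1

/-- With parameter δ/2 the quadratic bound on the exponential already gives -δ²x/4 - 0.505δ³x, which
leaves ample room for the constant 1/27. -/
lemma chernoff_exponent_le {δ l x : ℝ} (hδ₀ : 0 ≤ δ) (hδ₁ : δ ≤ 40 / 81) (hx : 0 ≤ x)
    (hl : l ≤ (1 - 2.02 * δ) * x) :
    l * (Real.exp (δ / 2) - 1) - δ / 2 * ((1 - 1.02 * δ) * x) ≤ -(δ ^ 2 / 27 * x) := by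
  have he := exp_le_one_add_add_sq (x := δ / 2) (by rw [abs_le]; constructor <;> linarith)
  have h1 := mul_le_mul_of_nonneg_right hl
    (by linarith [Real.add_one_le_exp (δ / 2)] : 0 ≤ Real.exp (δ / 2) - 1)
  have h2 : (1 - 2.02 * δ) * x * (Real.exp (δ / 2) - 1) ≤
      (1 - 2.02 * δ) * x * (δ / 2 + (δ / 2) ^ 2) := by
    rcases le_or_gt 0 (1 - 2.02 * δ) with h | h
    · exact mul_le_mul_of_nonneg_left (by linarith) (mul_nonneg h hx)
    · linarith
  have h3 : 0 ≤ x * δ ^ 2 := by positivity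
  have h4 : 0 ≤ x * δ ^ 3 := by positivity
  linarith

/-- Loners outnumber adversarial blocks on all intervals with one end in a given unit interval
ending at `u` and the other in a given unit interval starting at `v`. -/
lemma loners_gt_adversarial [IsProbabilityMeasure Pr] (hX : IsPrismSystem Pr α β X) (hα : 0 < α)
    (hβ : 0 ≤ β) (hΔ : 0 < Δ) (hδ₀ : 0 < δ) (hδ₁ : δ < 40 / 81)
    (hαβ : β < (1 - 81 / 40 * δ) * g α Δ ^ 2 * α) (j : Fin (m + 1)) {u v w : ℝ} (hu : 0 ≤ u)
    (hw : v - u = w) (hw1 : 648 * (1 + Δ) ≤ δ * w) (hw2 : 200 ≤ δ * (g α Δ ^ 2 * α * w)) :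
    ∃ E : Set Ω, MeasurableSet E ∧ Pr.real E ≤ 4 * Real.exp (-(eta α Δ δ / 27 * w)) ∧
      ∀ ω, ω ∉ E → ∀ a b, 0 ≤ a → u - 1 < a → a ≤ u → v ≤ b → b < v + 1 →
        (((X ω).tree j).adversarialBlocks a b).ncard + 2 ≤
          (((X ω).tree j).loners Δ (a + Δ) (b - Δ)).ncard := by
  have hw0 : 0 < w := by
    by_contra h
    nlinarith
  set ρ := g α Δ ^ 2 * α with hρ
  have hρ0 : 0 < ρ := mul_pos (pow_pos (Real.exp_pos _) 2) hα
  have heta : eta α Δ δ = δ ^ 2 * ρ := by rw [eta, hρ]; ring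
  have hρw : 0 < ρ * w := by positivity
  -- The cells are fine enough for discretization to cost at most a factor 1 - δ/1000.
  obtain ⟨n, hn⟩ := exists_nat_gt (α * Δ / (δ / 1000))
  have hn0' : (0 : ℝ) < n := lt_of_le_of_lt (by positivity) hn
  have hn0 : 0 < n := by exact_mod_cast hn0'
  have hexp : 1 - δ / 1000 ≤ Real.exp (-(α * Δ / n)) := by
    have h1 : α * Δ / n ≤ δ / 1000 := by
      rw [div_le_iff₀ hn0']
      rw [div_lt_iff₀ (by positivity)] at hn
      linarith
    linarith [Real.add_one_le_exp (-(α * Δ / n))]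
  -- The detected loners must fit into `(u + Δ, v - Δ]`; rounding to a multiple of 3Δ loses at most
  -- 3Δ more.
  set K := ⌊(w - 2 * Δ) / (3 * Δ)⌋₊ with hK
  have hwΔ : 5 * Δ ≤ w * (δ / 120) := by linarith
  have hwΔ' : 5 * Δ ≤ w := by nlinarith
  have hK1 : 3 * K * Δ ≤ w - 2 * Δ := by
    have := Nat.floor_le (a := (w - 2 * Δ) / (3 * Δ)) (div_nonneg (by linarith) (by positivity))
    rw [le_div_iff₀ (by positivity)] at this
    linarith
  have hK2 : w - 5 * Δ ≤ 3 * K * Δ := by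
    have := (Nat.lt_floor_add_one ((w - 2 * Δ) / (3 * Δ))).le
    rw [div_le_iff₀ (by positivity)] at this
    linarith
  set q := α * Δ * g α Δ ^ 2 * Real.exp (-(α * Δ / n)) with hq
  have hKq : (1 - δ / 100) * (ρ * w) ≤ 3 * (K * q) := by
    have e : 3 * (K * q) = ρ * (3 * K * Δ) * Real.exp (-(α * Δ / n)) := by rw [hq, hρ]; ring
    rw [e]
    have h1 : ρ * w * (1 - δ / 120) ≤ ρ * (3 * K * Δ) := by
      rw [mul_assoc]; exact mul_le_mul_of_nonneg_left (by linarith) hρ0.le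
    have h2 : ρ * w * (1 - δ / 120) * (1 - δ / 1000) ≤
        ρ * (3 * K * Δ) * Real.exp (-(α * Δ / n)) :=
      mul_le_mul h1 hexp (by linarith) (by positivity)
    refine le_trans ?_ h2
    have h3 : 0 ≤ ρ * w * δ := by positivity
    have h4 : 0 ≤ ρ * w * δ ^ 2 := by positivity
    nlinarith
  obtain ⟨E₁, hE₁, hP₁, hL⟩ := loners_tail hX hα.le hΔ j hu hn0 K hδ₀.le (by linarith) hq
  have hy : 0 ≤ (1 - 1.02 * δ) * (ρ * w) := mul_nonneg (by linarith) hρw.le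
  obtain ⟨E₂, hE₂, hP₂, hZ⟩ := adversarial_tail hX hβ j (u := max (u - 1) 0) (v := v + 1)
    (θ := δ / 2) (le_max_right _ _) (max_lt (by linarith) (by linarith)) (by positivity) hy
  refine ⟨E₁ ∪ E₂, hE₁.union hE₂, (measureReal_union_le _ _).trans ?_, ?_⟩
  · have b1 : Real.exp (-(δ ^ 2 / 4 * (K * q))) ≤ Real.exp (-(eta α Δ δ / 27 * w)) := by
      rw [Real.exp_le_exp, heta, neg_le_neg_iff]
      have h1 : (1 / 2) * (ρ * w) ≤ 3 * (K * q) :=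
        le_trans (mul_le_mul_of_nonneg_right (by linarith) hρw.le) hKq
      have := mul_le_mul_of_nonneg_left h1 (by positivity : 0 ≤ δ ^ 2 / 12)
      have h3 : 0 ≤ δ ^ 2 * (ρ * w) := by positivity
      linarith
    have b2 : Real.exp (β * (v + 1 - max (u - 1) 0) * (Real.exp (δ / 2) - 1) -
        δ / 2 * ((1 - 1.02 * δ) * (ρ * w))) ≤ Real.exp (-(eta α Δ δ / 27 * w)) := by
      rw [Real.exp_le_exp, heta, show δ ^ 2 * ρ / 27 * w = δ ^ 2 / 27 * (ρ * w) by ring]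
      refine chernoff_exponent_le hδ₀.le hδ₁.le hρw.le ?_
      -- Enlarging the interval by 1 at both ends costs a factor 1 + δ/300, which turns 81/40 =
      -- 2.025 into 2.02 at worst.
      have hlen : v + 1 - max (u - 1) 0 ≤ w * (1 + δ / 300) := by
        have := le_max_left (u - 1) 0
        linarith
      have hlen0 : 0 ≤ v + 1 - max (u - 1) 0 :=
        sub_nonneg.2 (max_le (by linarith) (by linarith))
      refine (mul_le_mul (by rw [hρ]; linarith) hlen hlen0 (mul_nonneg (by linarith) hρ0.le) :
        _ ≤ (1 - 81 / 40 * δ) * ρ * (w * (1 + δ / 300))).trans ?_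
      have h3 : 0 ≤ ρ * w * δ := by positivity
      have h4 : 0 ≤ ρ * w * δ ^ 2 := by positivity
      linarith
    linarith [hP₁, hP₂, b1, b2]
  · intro ω hω a b ha hua hau hvb hbv
    rw [Set.mem_union, not_or] at hω
    have h1 := hL ω hω.1
    have h2 := hZ ω hω.2
    have h3 : ((((X ω).tree j).adversarialBlocks a b).ncard : ℝ) ≤
        (((X ω).tree j).adversarialBlocks (max (u - 1) 0) (v + 1)).ncard := by
      exact_mod_cast Set.ncard_le_ncard
        (BlockTree.adversarialBlocks_mono _ (max_le hua.le ha) hbv.le)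
        (BlockTree.finite_adversarialBlocks _ _ _)
    have h4 : ((((X ω).tree j).loners Δ (u + Δ) (u + Δ + (3 * K : ℕ) * Δ)).ncard : ℝ) ≤
        (((X ω).tree j).loners Δ (a + Δ) (b - Δ)).ncard := by
      have hb : u + Δ + (3 * K : ℕ) * Δ ≤ b - Δ := by push_cast; linarith
      exact_mod_cast Set.ncard_le_ncard
        (BlockTree.loners_mono _ (by linarith) hb) (BlockTree.finite_loners _ _ _ _)
    have h5 := mul_le_mul_of_nonneg_left hKq (by linarith : 0 ≤ 1 - δ)
    have h6 : (1 - 1.01 * δ) * (ρ * w) ≤ (1 - δ) * ((1 - δ / 100) * (ρ * w)) := by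
      have : 0 ≤ ρ * w * δ ^ 2 := by positivity
      nlinarith
    -- The thresholds (1 - 1.01δ)ρw and (1 - 1.02δ)ρw differ by 0.01δρw ≥ 2, by `hw2`.
    have h7 : ((((X ω).tree j).adversarialBlocks a b).ncard : ℝ) + 2 ≤
        (((X ω).tree j).loners Δ (a + Δ) (b - Δ)).ncard := by linarith
    exact_mod_cast h7

/-- Loners outnumber adversarial blocks on all intervals around `(s, t]`. -/
lemma loners_gt_adversarial_around [IsProbabilityMeasure Pr] (hX : IsPrismSystem Pr α β X)
    (hα : 0 < α) (hβ : 0 ≤ β) (hΔ : 0 < Δ) (hδ₀ : 0 < δ) (hδ₁ : δ < 40 / 81)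
    (hαβ : β < (1 - 81 / 40 * δ) * g α Δ ^ 2 * α) (j : Fin (m + 1)) {s t w : ℝ}
    (hw : t - s = w) (hw1 : 648 * (1 + Δ) ≤ δ * w) (hw2 : 200 ≤ δ * (g α Δ ^ 2 * α * w)) :
    ∃ E : Set Ω, MeasurableSet E ∧
      Pr.real E ≤ 4 * Real.exp (-(eta α Δ δ / 27 * w)) / (1 - Real.exp (-(1 / 27 * eta α Δ δ))) ^ 2
      ∧ ∀ ω, ω ∉ E → ∀ a b, 0 ≤ a → a ≤ s → t ≤ b →
        (((X ω).tree j).adversarialBlocks a b).ncard + 2 ≤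
          (((X ω).tree j).loners Δ (a + Δ) (b - Δ)).ncard := by
  set r := Real.exp (-(1 / 27 * eta α Δ δ)) with hr
  have heta : 0 < eta α Δ δ := by unfold eta g; positivity
  have hr1 : r < 1 := by rw [hr, Real.exp_lt_one_iff]; linarith
  have hr0 : 0 ≤ r := (Real.exp_pos _).le
  have hr1' : 0 < 1 - r := by linarith
  have key : ∀ i k : ℕ, ∃ E : Set Ω, MeasurableSet E ∧
      Pr.real E ≤ 4 * Real.exp (-(eta α Δ δ / 27 * w)) * r ^ i * r ^ k ∧
      ∀ ω, ω ∉ E → ∀ a b, 0 ≤ a → s - i - 1 < a → a ≤ s - i → t + k ≤ b → b < t + k + 1 →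
        (((X ω).tree j).adversarialBlocks a b).ncard + 2 ≤
          (((X ω).tree j).loners Δ (a + Δ) (b - Δ)).ncard := by
    intro i k
    by_cases hi : 0 ≤ s - i
    · have hw' : t + k - (s - i) = w + (i + k) := by linarith
      have hik : (0 : ℝ) ≤ i + k := by positivity
      have hg : 0 ≤ g α Δ ^ 2 * α := by positivity
      obtain ⟨E, hE, hP, hQ⟩ := loners_gt_adversarial hX hα hβ hΔ hδ₀ hδ₁ hαβ j hi hw'
        (by have := mul_nonneg hδ₀.le hik; linarith)
        (by have := mul_nonneg hδ₀.le (mul_nonneg hg hik); linarith)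
      refine ⟨E, hE, hP.trans_eq ?_, hQ⟩
      rw [hr, ← Real.exp_nat_mul, ← Real.exp_nat_mul, mul_assoc, mul_assoc, ← Real.exp_add,
        ← Real.exp_add]
      congr 2; ring
    -- Here the range for `a` is negative, so there is nothing to prove.
    · refine ⟨∅, MeasurableSet.empty, by simp; positivity, fun ω _ a b ha _ hau => ?_⟩
      exact absurd (ha.trans hau) hi
  have key2 := exists_union_of_geometric (Pr := Pr) (A := 4 * Real.exp (-(eta α Δ δ / 27 * w)) / (1 - r))
    (by positivity) hr0 hr1 fun i => by
      have := exists_union_of_geometric (by positivity) hr0 hr1 (key i)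
      rwa [mul_div_right_comm] at this
  obtain ⟨E, hE, hP, hQ⟩ := key2
  refine ⟨E, hE, hP.trans_eq (by rw [div_div, sq]), fun ω hω a b ha has htb => ?_⟩
  have h1 := Nat.floor_le (sub_nonneg.2 has)
  have h2 := Nat.lt_floor_add_one (s - a)
  have h3 := Nat.floor_le (sub_nonneg.2 htb)
  have h4 := Nat.lt_floor_add_one (b - t)
  exact hQ ω hω ⌊s - a⌋₊ ⌊b - t⌋₊ a b ha (by linarith) (by linarith) (by linarith) (by linarith)

end

/-! ### Votes and permanence of leader sequences. -/

namespace Outcome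

variable {m : ℕ} {Δ : ℝ} (X : Outcome m Δ)

lemma height_of_chainVote_eq_some {j : Fin m} {k l p : ℕ}
    (h : (X.tree j.succ).chainVote (X.vote j) k l = some p) : (X.tree 0).height p = l := by
  obtain ⟨b, -, hb⟩ := List.exists_of_findSome?_eq_some h
  exact (X.vote_valid j b l p hb).1

/-- The blockchain of an honest voter block has a vote on every height that has had a published
block for at least `Δ`. -/
lemma chainVote_isSome {j : Fin m} {k l : ℕ} (hk0 : k ≠ 0) (hl : l ≠ 0)
    (hk : (X.tree j.succ).honest k)
    (h : (X.tree 0).firstPublished l ≤ (((X.tree j.succ).T k - Δ : ℝ) : EReal)) :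
    ((X.tree j.succ).chainVote (X.vote j) k l).isSome := by
  have e : (X.tree j.succ).chainVote (X.vote j) k l =
      ((X.tree j.succ).chainVote (X.vote j) ((X.tree j.succ).parent k) l).or (X.vote j k l) := by
    simp [BlockTree.chainVote, (X.tree j.succ).chain_of_ne_zero hk0, List.findSome?_append]
  rw [e, Option.isSome_or, Bool.or_eq_true]
  cases hp : (X.tree j.succ).chainVote (X.vote j) ((X.tree j.succ).parent k) l with
  | none => exact Or.inr (X.honest_votes j k l hk0 hl hk h hp)
  | some p => exact Or.inl rfl

/-- Since some vote is cast, a most voted block has a positive count. The publication clause, the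
only one depending on time, is then irrelevant. -/
lemma mostVoted_eq {c c' : Fin m → ℕ} {t t' : ℝ} {l : ℕ} (hm : 0 < m)
    (hc : ∀ j, ((X.tree j.succ).chainVote (X.vote j) (c j) l).isSome ∧
      (X.tree j.succ).chainVote (X.vote j) (c' j) l = (X.tree j.succ).chainVote (X.vote j) (c j) l) :
    X.mostVoted c t l = X.mostVoted c' t' l := by
  have hcount : ∀ p, X.voteCount c' l p = X.voteCount c l p := fun p => by
    simp only [voteCount, (hc _).2]
  obtain ⟨p₀, hp₀⟩ := Option.isSome_iff_exists.1 (hc ⟨0, hm⟩).1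
  have hpos : ∀ p, (∀ q, (X.tree 0).height q = l → X.voteCount c l q ≤ X.voteCount c l p) →
      0 < X.voteCount c l p := fun p hp => by
    refine lt_of_lt_of_le (Finset.card_pos.2 ⟨⟨0, hm⟩, ?_⟩) (hp p₀ (X.height_of_chainVote_eq_some hp₀))
    exact Finset.mem_filter.2 ⟨Finset.mem_univ _, hp₀⟩
  ext p
  simp only [mostVoted, hcount, Set.mem_ofPred_eq]
  exact and_congr_right fun _ => and_congr_left fun h => by simp [hpos p h]

/-- If credible voter blockchains share honest blocks mined more than `Δ` after the first
publication at height `h`, then the `h`-high prefix of a credible leader sequence is permanent. -/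
theorem isPermanentAfter_of_common_honest (hm : 0 < m) {h : ℕ} {s t : ℝ} (hs : 0 ≤ s)
    (hR : X.R h ≤ ((s - Δ : ℝ) : EReal)) (hst' : X.R h < ((t - Δ : ℝ) : EReal))
    (hcommon : ∀ (j : Fin m) r r' c c', t ≤ r → t ≤ r' → (X.tree j.succ).IsCredible Δ r c →
      (X.tree j.succ).IsCredible Δ r' c' → ∃ k, (X.tree j.succ).honest k ∧
        s < (X.tree j.succ).T k ∧ (X.tree j.succ).T k ≤ t ∧ k ∈ (X.tree j.succ).chain c ∧
          k ∈ (X.tree j.succ).chain c') {L : List ℕ} (hL : X.IsCredibleLeaderSequence t L) :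
    h < L.length ∧ X.IsPermanentAfter t (L.take (h + 1)) := by
  have hlen : ∀ r, t ≤ r → ∀ L, X.IsCredibleLeaderSequence r L → h < L.length := by
    intro r hr L hL
    obtain ⟨k, hk⟩ := iInf_lt_iff.1 hst'
    obtain ⟨hkh, hk⟩ := iInf_lt_iff.1 hk
    rw [← hkh]
    exact hL.2.1 k (hk.le.trans (by exact_mod_cast (by linarith : t - Δ ≤ r - Δ)))
  refine ⟨hlen t le_rfl L hL, fun r hr L' hL' => ?_⟩
  have h1 := hlen t le_rfl L hL
  have h2 := hlen r hr L' hL'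
  obtain ⟨hL0, -, c, hc, hcL⟩ := hL
  obtain ⟨hL0', -, c', hc', hcL'⟩ := hL'
  suffices hEq : ∀ l, l ≤ h → L[l]? = L'[l]? by
    rw [List.prefix_iff_eq_take, List.length_take, min_eq_left (by omega)]
    refine List.ext_getElem? fun l => ?_
    by_cases hl : l < h + 1
    · rw [List.getElem?_take_of_lt hl, List.getElem?_take_of_lt hl, hEq l (by omega)]
    · rw [List.getElem?_take_eq_none (by omega), List.getElem?_take_eq_none (by omega)]
  intro l hl
  by_cases hl0 : l = 0
  · subst hl0; rw [hL0, hL0']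
  have g1 : L[l]? = some L[l] := List.getElem?_eq_getElem (by omega)
  have g2 : L'[l]? = some L'[l] := List.getElem?_eq_getElem (by omega)
  have e1 := (hcL l _ hl0 g1).2
  have e2 := (hcL' l _ hl0 g2).2
  -- The tie-breaking rule depends only on the set of tied blocks, so equal sets give equal leaders.
  rw [g1, g2, e1, e2, X.mostVoted_eq (t := t) (t' := r) hm fun j => ?_]
  obtain ⟨k, hk, hks, -, hkc, hkc'⟩ := hcommon j t r (c j) (c' j) le_rfl hr (hc j) (hc' j)
  have hk0 : k ≠ 0 := by
    rintro rfl
    rw [(X.tree j.succ).T_zero] at hks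
    linarith
  have hsome := X.chainVote_isSome hk0 hl0 hk ((((X.tree 0).firstPublished_mono hl).trans hR).trans
    (by exact_mod_cast (by linarith : s - Δ ≤ (X.tree j.succ).T k - Δ)))
  rw [(X.tree j.succ).chainVote_eq_of_mem hkc hsome, (X.tree j.succ).chainVote_eq_of_mem hkc' hsome]
  exact ⟨hsome, rfl⟩

end Outcome

/-! ### Numerical bounds for the confirmation delay. -/

section Parameters

variable {α Δ δ ε : ℝ} {m : ℕ}

/-- Lower bounds for the confirmation delay. -/
lemma confirmationDelay_bounds (hα : 0 < α) (hΔ : 0 < Δ) (hδ₀ : 0 < δ) (hδ₁ : δ < 40 / 81)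
    (hm : 0 < m) (hε₀ : 0 < ε) (hε₁ : ε < 1)
    (hε : ε < m * mu α Δ δ * Real.exp (-(3 * (1 + Δ) * δ * g α Δ ^ 2 * α))) :
    648 * (1 + Δ) ≤ δ * (confirmationDelay m α Δ δ ε - Δ) ∧
    200 ≤ δ * (g α Δ ^ 2 * α * (confirmationDelay m α Δ δ ε - Δ)) ∧
    4 * Real.exp (-(eta α Δ δ / 27 * (confirmationDelay m α Δ δ ε - Δ))) /
      (1 - Real.exp (-(1 / 27 * eta α Δ δ))) ^ 2 ≤ ε / m := by
  have hm' : (1 : ℝ) ≤ m := by exact_mod_cast hm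
  have hg0 : 0 < g α Δ := Real.exp_pos _
  have hg1 : g α Δ < 1 := by
    rw [g, Real.exp_lt_one_iff]
    have : 0 < α * Δ := by positivity
    linarith
  set η := eta α Δ δ with hη
  have hη0 : 0 < η := by rw [hη]; unfold eta; positivity
  set W := confirmationDelay m α Δ δ ε - Δ with hW
  set Λ := Real.log (m * mu α Δ δ / ε) with hΛ
  set d := 1 - Real.exp (-(1 / 27 * η)) with hd
  have hd0 : 0 < d := by
    have : Real.exp (-(1 / 27 * η)) < 1 := Real.exp_lt_one_iff.2 (by linarith)
    linarith
  have hd1 : d ≤ 1 := by linarith [Real.exp_pos (-(1 / 27 * η))]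
  have hmu : mu α Δ δ = 9 * Real.exp (2 / 27 * η) / d ^ 2 := rfl
  have hmu9 : 9 ≤ mu α Δ δ := by
    rw [hmu, le_div_iff₀ (by positivity)]
    have h1 : (1 : ℝ) ≤ Real.exp (2 / 27 * η) := Real.one_le_exp (by positivity)
    have h2 : d ^ 2 ≤ 1 := pow_le_one₀ hd0.le hd1
    linarith
  have hratio : 9 ≤ m * mu α Δ δ / ε := by
    rw [le_div_iff₀ hε₀]
    nlinarith
  -- This is e² < 9.
  have hΛ2 : 2 ≤ Λ := by
    rw [hΛ, Real.le_log_iff_exp_le (by linarith)]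
    have h1 : Real.exp 2 = Real.exp 1 * Real.exp 1 := by rw [← Real.exp_add]; norm_num
    rw [h1]
    nlinarith [Real.exp_one_lt_d9, Real.exp_pos 1]
  have hΛ3 : 3 * (1 + Δ) * δ * g α Δ ^ 2 * α ≤ Λ := by
    rw [hΛ, Real.le_log_iff_exp_le (by linarith), le_div_iff₀ hε₀]
    have := mul_le_mul_of_nonneg_left hε.le
      (Real.exp_pos (3 * (1 + Δ) * δ * g α Δ ^ 2 * α)).le
    rw [mul_left_comm, ← Real.exp_add, add_neg_cancel, Real.exp_zero, mul_one] at this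
    exact this
  have hWΛ : 216 * Λ ≤ η * W := by
    -- The maximum of (1 - g)g is 1/4, so dividing by the denominator gains a factor of at least
    -- 4/α, and 216 = 4 · 54.
    have hD : (1 - 41 / 40 * δ) * (1 - g α Δ) * g α Δ * α ≤ α / 4 := by
      have h1 : (1 - g α Δ) * g α Δ ≤ 1 / 4 := by nlinarith [sq_nonneg (g α Δ - 1 / 2)]
      have h2 : 0 ≤ (1 - g α Δ) * g α Δ := mul_nonneg (by linarith) hg0.le
      have h3 : (1 - 41 / 40 * δ) * ((1 - g α Δ) * g α Δ) ≤ 1 / 4 := by nlinarith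
      nlinarith
    have hD0 : 0 < (1 - 41 / 40 * δ) * (1 - g α Δ) * g α Δ * α := by
      have h1 : 0 < 1 - 41 / 40 * δ := by linarith
      have h2 : 0 < 1 - g α Δ := by linarith
      positivity
    have hWeq : W = (54 * α / η * Λ + 4 * α * Δ + 1) /
        ((1 - 41 / 40 * δ) * (1 - g α Δ) * g α Δ * α) := by
      rw [hW, confirmationDelay, hΛ, hη]; ring
    have h1 : 54 * α / η * Λ / (α / 4) ≤ W := by
      rw [hWeq]
      refine div_le_div₀ (by positivity) ?_ hD0 hD
      have : 0 < α * Δ := by positivity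
      linarith
    have h2 : 54 * α / η * Λ / (α / 4) = 216 * Λ / η := by field_simp; norm_num
    rw [h2, div_le_iff₀ hη0] at h1
    linarith
  have hηeq : η = δ * (δ * (g α Δ ^ 2 * α)) := by rw [hη, eta]; ring
  have hc0 : 0 < δ * (g α Δ ^ 2 * α) := by positivity
  refine ⟨?_, ?_, ?_⟩
  · refine le_of_mul_le_mul_left ?_ hc0
    calc δ * (g α Δ ^ 2 * α) * (648 * (1 + Δ)) =
          216 * (3 * (1 + Δ) * δ * g α Δ ^ 2 * α) := by ring
      _ ≤ 216 * Λ := by linarith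
      _ ≤ η * W := hWΛ
      _ = δ * (g α Δ ^ 2 * α) * (δ * W) := by rw [hηeq]; ring
  · have h1 : η * W = δ * (δ * (g α Δ ^ 2 * α * W)) := by rw [hηeq]; ring
    by_contra! hlt
    have := mul_lt_mul_of_pos_left hlt hδ₀
    linarith
  · have hεm : ε / m = mu α Δ δ * Real.exp (-Λ) := by
      rw [Real.exp_neg, hΛ, Real.exp_log (by linarith)]
      field_simp
    rw [hεm, hmu, div_mul_eq_mul_div (9 * Real.exp (2 / 27 * η))]
    refine div_le_div_of_nonneg_right ?_ (sq_nonneg d)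
    -- Only ηW/27 ≥ Λ is needed here, whereas `hWΛ` gives 8Λ.
    have h1 : Real.exp (-(η / 27 * W)) ≤ Real.exp (-Λ) := Real.exp_le_exp.2 (by linarith)
    have h2 : (1 : ℝ) ≤ Real.exp (2 / 27 * η) := Real.one_le_exp (by positivity)
    nlinarith [Real.exp_pos (-Λ)]

end Parameters

end Prism

theorem mainTheorem10 {Ω : Type*} [MeasurableSpace Ω] (Pr : Measure Ω) [IsProbabilityMeasure Pr]
    (m : ℕ) (α β δ Δ : ℝ) (hα : 1 / 2 < α) (hβ : 0 ≤ β) (hΔ : 0 < Δ)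
    (hδ₀ : 0 < δ) (hδ₁ : δ < 40 / 81)
    (hαβ : β < (1 - 81 / 40 * δ) * Prism.g α Δ ^ 2 * α)
    (X : Ω → Prism.Outcome m Δ) (hX : Prism.IsPrismSystem Pr α β X)
    (h : ℕ) (hh : 1 ≤ h) (ε : ℝ) (hε₀ : 0 < ε)
    (hε : ε < m * Prism.mu α Δ δ * Real.exp (-(3 * (1 + Δ) * δ * Prism.g α Δ ^ 2 * α)))
    (t : ℝ) :
    ∃ A : Set Ω, MeasurableSet A ∧ ENNReal.ofReal (1 - ε) ≤ Pr A ∧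
      ∀ ω ∈ A, (X ω).R h + (Prism.confirmationDelay m α Δ δ ε : EReal) ≤ (t : EReal) →
        ∀ L : List ℕ, (X ω).IsCredibleLeaderSequence t L →
          h < L.length ∧ (X ω).IsPermanentAfter t (L.take (h + 1)) := by
  have hα0 : 0 < α := by linarith
  rcases le_or_gt 1 ε with hε₁ | hε₁
  · exact ⟨∅, MeasurableSet.empty, by simp [hε₁], by simp⟩
  -- For m = 0 the upper bound on `ε` would be 0.
  have hm : 0 < m := by
    rcases Nat.eq_zero_or_pos m with h0 | h0
    · subst h0
      simp at hε
      linarith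
    · exact h0
  have hm' : (0 : ℝ) < m := by exact_mod_cast hm
  obtain ⟨hw1, hw2, hw3⟩ := Prism.confirmationDelay_bounds hα0 hΔ hδ₀ hδ₁ hm hε₀ hε₁ hε
  set C := Prism.confirmationDelay m α Δ δ ε with hC
  have hCΔ : 0 < C - Δ := by
    by_contra hlt
    nlinarith
  -- The interval `(s, t]` has length `C - Δ`, and R_h + C ≤ t gives R_h ≤ s - Δ. Each voter tree
  -- contributes at most ε/m to the failure probability.
  have hE := fun j : Fin m => Prism.loners_gt_adversarial_around hX hα0 hβ hΔ hδ₀ hδ₁ hαβ j.succ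
    (s := t - C + Δ) (t := t) (by ring) hw1 hw2
  choose E hE hPE hgood using hE
  refine ⟨(⋃ j, E j)ᶜ, (MeasurableSet.iUnion hE).compl, ?_, fun ω hω hR L hL => ?_⟩
  · rw [ENNReal.ofReal_le_iff_le_toReal (measure_ne_top _ _), ← measureReal_def,
      measureReal_compl (MeasurableSet.iUnion hE), probReal_univ]
    have h1 := measureReal_iUnion_fintype_le (μ := Pr) E
    have h2 : ∑ j, Pr.real (E j) ≤ ∑ _j : Fin m, ε / m :=
      Finset.sum_le_sum fun j _ => (hPE j).trans hw3
    rw [Finset.sum_const, Finset.card_univ, Fintype.card_fin, nsmul_eq_mul,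
      mul_div_cancel₀ _ hm'.ne'] at h2
    linarith
  · have hR0 : 0 ≤ (X ω).R h := ((X ω).tree 0).firstPublished_nonneg h
    have hRt : (X ω).R h ≤ ((t - C : ℝ) : EReal) := by
      rw [EReal.coe_sub]
      exact EReal.le_sub_iff_add_le (by simp) (by simp) |>.2 hR
    have htC : 0 ≤ t - C := by exact_mod_cast hR0.trans hRt
    refine (X ω).isPermanentAfter_of_common_honest hm (s := t - C + Δ) (by linarith)
      (by simpa using hRt) (hRt.trans_lt (by exact_mod_cast (by linarith : t - C < t - Δ)))
      (fun j r r' c c' hr hr' hc hc' => ?_) hL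
    refine Prism.BlockTree.exists_common_honest ((X ω).honestRule j.succ) (by linarith)
      (by linarith) (fun a b ha has htb => ?_) hr hr' hc hc'
    exact hgood j ω (fun hj => hω (Set.mem_iUnion.2 ⟨j, hj⟩)) a b ha has htb
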